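/- Let $\mathbf C$ be a (strict) cubical $\omega$-category with connections in the sense of Al-Agl, Brown and Steiner: sets $\mathbf C_n$ ($n\ge 0$) with faces $\partial_i^\alpha:\mathbf C_n\to\mathbf C_{n-1}$ ($1\le i\le n$, $\alpha=\pm$), degeneracies $\epsilon_i:\mathbf C_{n}\to\mathbf C_{n+1}$ ($1\le i\le n+1$), connections $\Gamma_i^\alpha:\mathbf C_n\to\mathbf C_{n+1}$ ($1\le i\le n$) and partial compositions $A\star_i B$ on $\mathbf C_n$ ($1\le i\le n$), defined exactly when $\partial_i^+A=\partial_i^-B$, subject to the usual axioms; in particular $\partial_i^\alpha\Gamma_i^\alpha=\partial_{i+1}^\alpha\Gamma_i^\alpha=\mathrm{id}$, $\partial_i^{\alpha}\Gamma_i^{-\alpha}=\partial_{i+1}^{\alpha}\Gamma_i^{-\alpha}=\epsilon_i\partial_i^{\alpha}$, $\Gamma_i^+A\star_i\Gamma_i^-A=\epsilon_{i+1}A$ and $\Gamma_i^+A\star_{i+1}\Gamma_i^-A=\epsilon_iA$. Use the following definitions. * A cell $A\in\mathbf C_n$ is $R_i$-invertible ($1\le i\le n$) if there is $B\in\mathbf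 C_n$ with $A\star_iB=\epsilon_i\partial_i^-A$ and $B\star_iA=\epsilon_i\partial_i^+A$ (in particular, these composites are defined). * For $1\le i<n$ and $A\in\mathbf C_n$ put $\psi_iA=\Gamma_i^+\partial_{i+1}^-A\star_{i+1}A\star_{i+1}\Gamma_i^-\partial_{i+1}^+A$. A cell $A\in\mathbf C_n$ with $n\ge1$ is invertible if $\psi_1\psi_2\cdots\psi_{n-1}A$ is $R_1$-invertible. * A cell $A\in\mathbf C_n$ is $T_i$-invertible ($1\le i<n$) if there is $B\in\mathbf C_n$ with $\partial_i^\alpha A=\partial_{i+1}^\alpha B$ and $\partial_{i+1}^\alpha A=\partial_i^\alpha B$ for $\alpha=\pm$, such that $$(\Gamma_i^+\partial_{i+1}^-A\star_iB)\star_{i+1}(A\star_i\Gamma_i^-\partial_i^+A)=\Gamma_i^-\partial_i^-A\star_i\Gamma_i^+\partial_{i+1}^+A$$ and the same equation holds with $A$ and $B$ exchanged. * For $p\ge 0$, $\mathbf C$ is a cubical $(\omega,p)$-category if, for every $n>p$, every $n$-cell is invertible; a cubical $\omega$-groupoid is a cubical $(\omega,0)$-category. Then: 1. $\mathbf C$ is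 a cubical $\omega$-groupoid if and only if, for all $n\ge1$ and all $1\le i\le n$, every $n$-cell of $\mathbf C$ is $R_i$-invertible. 2. $\mathbf C$ is a cubical $(\omega,1)$-category if and only if, for all $n\ge2$ and all $1\le i<n$, every $n$-cell of $\mathbf C$ is $T_i$-invertible. -/

import Mathlib

universe u

namespace Cubical

/-- `i` is a direction of an `n`-cube: `1 ≤ i ≤ n`. -/
abbrev InRange (i n : ℕ) : Prop := 1 ≤ i ∧ i ≤ n

/-- The index `j^i`: the increasing map from `ℕ` onto `ℕ \ {i}`. -/
def raise (j i : ℕ) : ℕ := if j < i then j else j + 1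

/-- The index `j_i` (used only for `j ≠ i`): the increasing map from `ℕ \ {i}` onto `ℕ`. -/
def lower (j i : ℕ) : ℕ := if j < i then j else j - 1

theorem raise_mem {i j n m : ℕ} (hj : InRange j n) (hm : n + 1 = m) : InRange (raise j i) m := by
  unfold raise; split <;> constructor <;> omega

theorem lower_mem {i j n : ℕ} (hj : InRange j (n + 1)) (hi : InRange i (n + 1)) (h : j ≠ i) :
    InRange (lower j i) n := by
  unfold lower; split <;> constructor <;> omega

theorem lower_mem_left {i j n : ℕ} (hj : InRange j (n + 1)) (hi : InRange i (n + 2))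
    (h : i ≠ j) (h' : i ≠ j + 1) : InRange (lower j i) n := by
  unfold lower; split <;> constructor <;> omega

theorem lower_mem_right {i j n : ℕ} (hj : InRange j (n + 1)) (hi : InRange i (n + 2))
    (h : i ≠ j) : InRange (lower i j) (n + 1) := by
  unfold lower; split <;> constructor <;> omega

theorem InRange.weaken {i n : ℕ} (hi : InRange i n) : InRange i (n + 1) := by
  constructor <;> omega

theorem InRange.next {i n : ℕ} (hi : InRange i n) : InRange (i + 1) (n + 1) := by
  constructor <;> omega

theorem InRange.one {n : ℕ} : InRange 1 (n + 1) := by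
  constructor <;> omega

end Cubical

open Cubical in
/-- Cubical sets with connections. The Boolean `false` stands for the sign `-` and `true` for the
sign `+`. The operations `face i`, `degen i`, `conn i` are `∂_i`, `ε_i`, `Γ_i`; directions are
numbered from `1`. -/
structure CubicalSet where
  /-- the set of `n`-cells -/
  cell : ℕ → Type u
  /-- faces `∂_i^α`, for `1 ≤ i ≤ n + 1` -/
  face {n : ℕ} (i : ℕ) (hi : InRange i (n + 1)) (α : Bool) : cell (n + 1) → cell n
  /-- degeneracies `ε_i`, for `1 ≤ i ≤ n + 1` -/
  degen {n : ℕ} (i : ℕ) (hi : InRange i (n + 1)) : cell n → cell (n + 1)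
  /-- connections `Γ_i^α`, for `1 ≤ i ≤ n` -/
  conn {n : ℕ} (i : ℕ) (hi : InRange i n) (α : Bool) : cell n → cell (n + 1)
  face_face {n i j : ℕ} (hi : InRange i (n + 2)) (hj : InRange j (n + 2)) (hij : i ≠ j)
    (α β : Bool) (A : cell (n + 2)) :
    face (lower j i) (lower_mem hj hi hij.symm) α (face i hi β A) =
      face (lower i j) (lower_mem hi hj hij) β (face j hj α A)
  face_degen {n i j : ℕ} (hi : InRange i (n + 2)) (hj : InRange j (n + 2)) (hij : i ≠ j)
    (α : Bool) (A : cell (n + 1)) :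
    face i hi α (degen j hj A) =
      degen (lower j i) (lower_mem hj hi hij.symm) (face (lower i j) (lower_mem hi hj hij) α A)
  face_degen_self {n i : ℕ} (hi : InRange i (n + 1)) (α : Bool) (A : cell n) :
    face i hi α (degen i hi A) = A
  face_conn {n i j : ℕ} (hi : InRange i (n + 2)) (hj : InRange j (n + 1)) (hij : i ≠ j)
    (hij' : i ≠ j + 1) (α β : Bool) (A : cell (n + 1)) :
    face i hi α (conn j hj β A) =
      conn (lower j i) (lower_mem_left hj hi hij hij') β
        (face (lower i j) (lower_mem_right hj hi hij) α A)
  face_conn_same {n j : ℕ} (hj : InRange j n) (α : Bool) (A : cell n) :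
    face j hj.weaken α (conn j hj α A) = A
  face_succ_conn_same {n j : ℕ} (hj : InRange j n) (α : Bool) (A : cell n) :
    face (j + 1) hj.next α (conn j hj α A) = A
  face_conn_opp {n j : ℕ} (hj : InRange j (n + 1)) (α : Bool) (A : cell (n + 1)) :
    face j hj.weaken α (conn j hj (!α) A) = degen j hj (face j hj α A)
  face_succ_conn_opp {n j : ℕ} (hj : InRange j (n + 1)) (α : Bool) (A : cell (n + 1)) :
    face (j + 1) hj.next α (conn j hj (!α) A) = degen j hj (face j hj α A)
  degen_degen {n i j : ℕ} (hi : InRange i (n + 2)) (hj : InRange j (n + 2)) (hij : i ≠ j)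
    (A : cell n) :
    degen i hi (degen (lower j i) (lower_mem hj hi hij.symm) A) =
      degen j hj (degen (lower i j) (lower_mem hi hj hij) A)
  conn_conn {n i j : ℕ} (hi : InRange i n) (hj : InRange j n) (hij : i ≠ j)
    (α β : Bool) (A : cell n) :
    conn (raise i j) (raise_mem hi rfl) α (conn j hj β A) =
      conn (raise j i) (raise_mem hj rfl) β (conn i hi α A)
  conn_conn_self {n i : ℕ} (hi : InRange i n) (α : Bool) (A : cell n) :
    conn (i + 1) hi.next α (conn i hi α A) = conn i hi.weaken α (conn i hi α A)
  conn_degen {n i j : ℕ} (hi : InRange i (n + 1)) (hj : InRange j (n + 1)) (hij : i ≠ j)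
    (α : Bool) (A : cell n) :
    conn i hi α (degen j hj A) =
      degen (raise j i) (raise_mem hj rfl) (conn (lower i j) (lower_mem hi hj hij) α A)
  conn_degen_self {n i : ℕ} (hi : InRange i (n + 1)) (α : Bool) (A : cell n) :
    conn i hi α (degen i hi A) = degen i hi.weaken (degen i hi A)

open Cubical in
/-- Cubical `ω`-categories (with connections). The composition `comp i` is `⋆_i`, a partial
operation, defined exactly on the pairs `A`, `B` with `∂_i^+ A = ∂_i^- B`. In the axioms, `∃` over
proofs of such equations says that the composites on both sides of the axiom are defined; this is
always a consequence of the axioms on faces. -/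
structure CubicalOmegaCategory extends CubicalSet.{u} where
  comp {n : ℕ} (i : ℕ) (hi : InRange i (n + 1)) (A B : cell (n + 1))
    (h : face i hi true A = face i hi false B) : cell (n + 1)
  face_comp {n i j : ℕ} (hi : InRange i (n + 2)) (hj : InRange j (n + 2)) (hij : i ≠ j)
    (α : Bool) (A B : cell (n + 2)) (h : face j hj true A = face j hj false B) :
    ∃ h', face i hi α (comp j hj A B h) =
      comp (lower j i) (lower_mem hj hi hij.symm) (face i hi α A) (face i hi α B) h'
  face_comp_source {n i : ℕ} (hi : InRange i (n + 1)) (A B : cell (n + 1))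
    (h : face i hi true A = face i hi false B) :
    face i hi false (comp i hi A B h) = face i hi false A
  face_comp_target {n i : ℕ} (hi : InRange i (n + 1)) (A B : cell (n + 1))
    (h : face i hi true A = face i hi false B) :
    face i hi true (comp i hi A B h) = face i hi true B
  exchange {n i j : ℕ} (hi : InRange i (n + 1)) (hj : InRange j (n + 1)) (hij : i ≠ j)
    (A B C D : cell (n + 1))
    (hAB : face i hi true A = face i hi false B) (hCD : face i hi true C = face i hi false D)
    (hAC : face j hj true A = face j hj false C) (hBD : face j hj true B = face j hj false D) :
    ∃ h h', comp j hj (comp i hi A B hAB) (comp i hi C D hCD) h =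
      comp i hi (comp j hj A C hAC) (comp j hj B D hBD) h'
  assoc {n i : ℕ} (hi : InRange i (n + 1)) (A B C : cell (n + 1))
    (hAB : face i hi true A = face i hi false B) (hBC : face i hi true B = face i hi false C) :
    ∃ h h', comp i hi A (comp i hi B C hBC) h = comp i hi (comp i hi A B hAB) C h'
  comp_degen {n i : ℕ} (hi : InRange i (n + 1)) (A : cell (n + 1)) :
    ∃ h, comp i hi A (degen i hi (face i hi true A)) h = A
  degen_comp {n i : ℕ} (hi : InRange i (n + 1)) (A : cell (n + 1)) :
    ∃ h, comp i hi (degen i hi (face i hi false A)) A h = A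
  degen_of_comp {n i j : ℕ} (hi : InRange i (n + 2)) (hj : InRange j (n + 1))
    (A B : cell (n + 1)) (h : face j hj true A = face j hj false B) :
    ∃ h', degen i hi (comp j hj A B h) =
      comp (raise j i) (raise_mem hj rfl) (degen i hi A) (degen i hi B) h'
  conn_comp_conn {n i : ℕ} (hi : InRange i n) (A : cell n) :
    ∃ h, comp i hi.weaken (conn i hi true A) (conn i hi false A) h = degen (i + 1) hi.next A
  conn_comp_succ_conn {n i : ℕ} (hi : InRange i n) (A : cell n) :
    ∃ h, comp (i + 1) hi.next (conn i hi true A) (conn i hi false A) h = degen i hi.weaken A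
  conn_of_comp {n i j : ℕ} (hi : InRange i (n + 1)) (hj : InRange j (n + 1)) (hij : i ≠ j)
    (α : Bool) (A B : cell (n + 1)) (h : face j hj true A = face j hj false B) :
    ∃ h', conn i hi α (comp j hj A B h) =
      comp (raise j i) (raise_mem hj rfl) (conn i hi α A) (conn i hi α B) h'
  conn_false_of_comp {n i : ℕ} (hi : InRange i (n + 1)) (A B : cell (n + 1))
    (h : face i hi true A = face i hi false B) :
    ∃ h₁ h₂ h₃, conn i hi false (comp i hi A B h) =
      comp (i + 1) hi.next
        (comp i hi.weaken (conn i hi false A) (degen (i + 1) hi.next B) h₁)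
        (comp i hi.weaken (degen i hi.weaken B) (conn i hi false B) h₂) h₃
  conn_true_of_comp {n i : ℕ} (hi : InRange i (n + 1)) (A B : cell (n + 1))
    (h : face i hi true A = face i hi false B) :
    ∃ h₁ h₂ h₃, conn i hi true (comp i hi A B h) =
      comp (i + 1) hi.next
        (comp i hi.weaken (conn i hi true A) (degen i hi.weaken A) h₁)
        (comp i hi.weaken (degen (i + 1) hi.next A) (conn i hi true B) h₂) h₃

namespace CubicalOmegaCategory

open Cubical

variable (C : CubicalOmegaCategory.{u})

/-- `R_k`-invertibility of a cell of positive dimension `n + 1`, for `1 ≤ k ≤ n + 1`. -/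
def IsRInvertible {n : ℕ} (k : ℕ) (hk : InRange k (n + 1)) (A : C.cell (n + 1)) : Prop :=
  ∃ B : C.cell (n + 1),
    (∃ h, C.comp k hk A B h = C.degen k hk (C.face k hk false A)) ∧
    (∃ h, C.comp k hk B A h = C.degen k hk (C.face k hk true A))

/-- The left composite `Γ_i^+ ∂_{i+1}^- A ⋆_{i+1} A` in the folding operation. -/
def foldLeft {n : ℕ} (i : ℕ) (hi : InRange i n) (A : C.cell (n + 1)) : C.cell (n + 1) :=
  C.comp (i + 1) hi.next (C.conn i hi true (C.face (i + 1) hi.next false A)) A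
    (C.face_succ_conn_same hi true _)

/-- The folding operation
`ψ_i A = Γ_i^+ ∂_{i+1}^- A ⋆_{i+1} A ⋆_{i+1} Γ_i^- ∂_{i+1}^+ A` on `(n + 1)`-cells, `1 ≤ i ≤ n`. -/
def fold {n : ℕ} (i : ℕ) (hi : InRange i n) (A : C.cell (n + 1)) : C.cell (n + 1) :=
  C.comp (i + 1) hi.next (C.foldLeft i hi A)
    (C.conn i hi false (C.face (i + 1) hi.next true A))
    ((C.face_comp_target hi.next _ _ _).trans (C.face_succ_conn_same hi false _).symm)

/-- The iterated folding `ψ_1 ⋯ ψ_k A` on `(n + 1)`-cells, for `k ≤ n` (`ψ_k` acts first). -/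
def foldUpTo {n : ℕ} : (k : ℕ) → k ≤ n → C.cell (n + 1) → C.cell (n + 1)
  | 0, _, A => A
  | k + 1, hk, A => foldUpTo k (Nat.le_of_succ_le hk) (C.fold (k + 1) ⟨Nat.succ_pos k, hk⟩ A)

/-- An `(n + 1)`-cell `A` is invertible if `ψ_1 ⋯ ψ_n A` is `R_1`-invertible. -/
def IsInvertible {n : ℕ} (A : C.cell (n + 1)) : Prop :=
  C.IsRInvertible 1 InRange.one (C.foldUpTo n le_rfl A)

/-- The equation
`(Γ_i^+ ∂_{i+1}^- A ⋆_i B) ⋆_{i+1} (A ⋆_i Γ_i^- ∂_i^+ A) = Γ_i^- ∂_i^- A ⋆_i Γ_i^+ ∂_{i+1}^+ A`,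
all composites being defined. -/
def TSquare {n : ℕ} (i : ℕ) (hi : InRange i n) (A B : C.cell (n + 1)) : Prop :=
  ∃ h₁ h₂ h₃ h₄,
    C.comp (i + 1) hi.next
      (C.comp i hi.weaken (C.conn i hi true (C.face (i + 1) hi.next false A)) B h₁)
      (C.comp i hi.weaken A (C.conn i hi false (C.face i hi.weaken true A)) h₂) h₃ =
    C.comp i hi.weaken (C.conn i hi false (C.face i hi.weaken false A))
      (C.conn i hi true (C.face (i + 1) hi.next true A)) h₄

/-- `B` is a `T_i`-inverse of the `(n + 1)`-cell `A`, where `1 ≤ i < n + 1`. -/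
def IsTInverse {n : ℕ} (i : ℕ) (hi : InRange i n) (A B : C.cell (n + 1)) : Prop :=
  (∀ α, C.face i hi.weaken α A = C.face (i + 1) hi.next α B) ∧
  (∀ α, C.face (i + 1) hi.next α A = C.face i hi.weaken α B) ∧
  C.TSquare i hi A B ∧ C.TSquare i hi B A

/-- `T_i`-invertibility of an `(n + 1)`-cell, where `1 ≤ i < n + 1`. -/
def IsTInvertible {n : ℕ} (i : ℕ) (hi : InRange i n) (A : C.cell (n + 1)) : Prop :=
  ∃ B : C.cell (n + 1), C.IsTInverse i hi A B

/-- A cubical `(ω,p)`-category: every cell of dimension `> p` is invertible. -/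
def IsOmegaPCategory (p : ℕ) : Prop :=
  ∀ n : ℕ, p < n + 1 → ∀ A : C.cell (n + 1), C.IsInvertible A

/-- A cubical `ω`-groupoid is a cubical `(ω,0)`-category. -/
def IsOmegaGroupoid : Prop := C.IsOmegaPCategory 0

end CubicalOmegaCategory

namespace CubicalOmegaCategory

open Cubical

variable {C : CubicalOmegaCategory.{u}} {n : ℕ}

/-! ### Total versions of the operations -/

/-! The folding `ψ_i A` turns `A` into a cell whose faces in direction `i + 1` are degenerate, so
that in directions `i`, `i + 1` it behaves like a 2-cell of a 2-category: `⋆_i` is vertical and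
`⋆_{i+1}` horizontal composition. Nothing is lost: `unfold_psi` rebuilds `A` from `ψ_i A` by
composing with connections and degeneracies of its faces.

Groupoids: for a 2-cell with invertible source and target, vertical and horizontal invertibility
agree (`HasInv.succ_of_degenerate`, `HasInv.of_succ_of_degenerate`). If the relevant faces of `A`
are invertible, so are the connections on them, and these can be cancelled. Hence `ψ_i A` being
`R_i`-invertible gives `A` both `R_{i+1}`-invertible (`HasInv.succ_of_psi`) and `R_i`-invertible
(`HasInv.of_psi`). By induction on dimension all faces are invertible. Undoing the foldings in `ψ_1
⋯ ψ_n A` one at a time raises the direction from 1 to `n + 1`, and refolding descends to every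
direction.

`(ω,1)`-categories: `A` is `T_i`-invertible exactly when `ψ_i A` is `R_i`-invertible
(`isTInvertible_iff`). Both sides of the `T_i` equation have the same boundary, so they agree as
soon as their foldings do, and those are `ψ_i A ⋆_i ψ_i B` and an identity. This property, `FoldInv
i`, is closed under composition in all directions. If it holds for all cells one dimension lower, it
also holds for the connections in the adjacent direction. It is therefore unaffected by `ψ_{i+1}`,
and likewise `FoldInv (i + 1)` is unaffected by `ψ_i`. So both `FoldInv i A` and `FoldInv (i + 1) A`
can be tested on `X = ψ_{i+1} ψ_i A`, where they say that `ψ_i X` is `R_i`-invertible and that `X`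
is `R_{i+1}`-invertible. The transfer used for groupoids identifies the two (`foldInv_succ_iff`),
and the same induction concludes.

In both parts the converse needs no induction: the hypothesis is applied in direction 1 to a folded
cell. -/

open Classical in
/-- The face `∂_i^α`, with a junk value when `i` is out of range. -/
noncomputable def fc (i : ℕ) (α : Bool) (A : C.cell (n + 1)) : C.cell n :=
  if h : InRange i (n + 1) then C.face i h α A else C.face 1 InRange.one α A

open Classical in
/-- The degeneracy `ε_i`, with a junk value when `i` is out of range. -/
noncomputable def dg (i : ℕ) (A : C.cell n) : C.cell (n + 1) :=
  if h : InRange i (n + 1) then C.degen i h A else C.degen 1 InRange.one A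

open Classical in
/-- The connection `Γ_i^α`, with a junk value when `i` is out of range. -/
noncomputable def cn (i : ℕ) (α : Bool) (A : C.cell n) : C.cell (n + 1) :=
  if h : InRange i n then C.conn i h α A else C.degen 1 InRange.one A

open Classical in
/-- The composite `A ⋆_i B`, with value `A` when it is not defined. -/
noncomputable def cm (i : ℕ) (A B : C.cell (n + 1)) : C.cell (n + 1) :=
  if h : ∃ hi : InRange i (n + 1), C.face i hi true A = C.face i hi false B then
    C.comp i h.1 A B h.2 else A

notation:70 A:70 "⋆[" i "]" B:71 => cm i A B

/-! ### The cubical axioms for the total operations -/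

theorem face_eq {i : ℕ} (hi : InRange i (n + 1)) (α : Bool) (A : C.cell (n + 1)) :
    C.face i hi α A = fc i α A := by simp [fc, hi]

theorem degen_eq {i : ℕ} (hi : InRange i (n + 1)) (A : C.cell n) :
    C.degen i hi A = dg i A := by simp [dg, hi]

theorem conn_eq {i : ℕ} (hi : InRange i n) (α : Bool) (A : C.cell n) :
    C.conn i hi α A = cn i α A := by simp [cn, hi]

theorem comp_eq {i : ℕ} (hi : InRange i (n + 1)) (A B : C.cell (n + 1))
    (h : C.face i hi true A = C.face i hi false B) :
    C.comp i hi A B h = cm i A B := by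
  unfold cm; rw [dif_pos ⟨hi, h⟩]

theorem lower_of_lt {i j : ℕ} (h : i < j) : lower i j = i := by simp [lower, h]
theorem lower_of_gt {i j : ℕ} (h : j < i) : lower i j = i - 1 := by
  simp [lower, not_lt.2 h.le]
theorem raise_of_lt {i j : ℕ} (h : i < j) : raise i j = i := by simp [raise, h]
theorem raise_of_ge {i j : ℕ} (h : j ≤ i) : raise i j = i + 1 := by simp [raise, not_lt.2 h]

theorem fc_fc {i j : ℕ} (hi : 1 ≤ i) (hij : i < j) (hj : j ≤ n + 2) (α β : Bool)
    (A : C.cell (n + 2)) : fc i α (fc j β A) = fc (j - 1) β (fc i α A) := by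
  have := C.face_face (i := j) (j := i) ⟨by omega, by omega⟩ ⟨hi, by omega⟩ (by omega) α β A
  simpa only [face_eq, lower_of_lt hij, lower_of_gt hij] using this

theorem fc_dg_lt {i j : ℕ} (hi : 1 ≤ i) (hij : i < j) (hj : j ≤ n + 2) (α : Bool)
    (A : C.cell (n + 1)) : fc i α (dg j A) = dg (j - 1) (fc i α A) := by
  have := C.face_degen (i := i) (j := j) ⟨hi, by omega⟩ ⟨by omega, by omega⟩ (by omega) α A
  simpa only [face_eq, degen_eq, lower_of_lt hij, lower_of_gt hij] using this

theorem fc_dg_gt {i j : ℕ} (hj : 1 ≤ j) (hij : j < i) (hi : i ≤ n + 2) (α : Bool)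
    (A : C.cell (n + 1)) : fc i α (dg j A) = dg j (fc (i - 1) α A) := by
  have := C.face_degen (i := i) (j := j) ⟨by omega, hi⟩ ⟨by omega, by omega⟩ (by omega) α A
  simpa only [face_eq, degen_eq, lower_of_lt hij, lower_of_gt hij] using this

theorem fc_dg_self (i : ℕ) (α : Bool) (A : C.cell n) : fc i α (dg i A) = A := by
  by_cases hi : InRange i (n + 1)
  · simpa only [face_eq, degen_eq] using C.face_degen_self hi α A
  · simp only [fc, dg, hi, dif_neg, not_false_eq_true]
    exact C.face_degen_self _ α A

theorem fc_cn_lt {i j : ℕ} (hi : 1 ≤ i) (hij : i < j) (hj : j ≤ n + 1) (α β : Bool)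
    (A : C.cell (n + 1)) : fc i α (cn j β A) = cn (j - 1) β (fc i α A) := by
  have := C.face_conn (i := i) (j := j) ⟨hi, by omega⟩ ⟨by omega, by omega⟩ (by omega) (by omega)
    α β A
  simpa only [face_eq, conn_eq, lower_of_lt hij, lower_of_gt hij] using this

theorem fc_cn_gt {i j : ℕ} (hj : 1 ≤ j) (hij : j + 1 < i) (hi : i ≤ n + 2) (α β : Bool)
    (A : C.cell (n + 1)) : fc i α (cn j β A) = cn j β (fc (i - 1) α A) := by
  have := C.face_conn (i := i) (j := j) ⟨by omega, hi⟩ ⟨by omega, by omega⟩ (by omega) (by omega)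
    α β A
  simpa only [face_eq, conn_eq, lower_of_lt (Nat.lt_of_succ_lt hij),
    lower_of_gt (Nat.lt_of_succ_lt hij)] using this

theorem fc_cn_same {i : ℕ} (hi : 1 ≤ i) (hn : i ≤ n) (α : Bool) (A : C.cell n) :
    fc i α (cn i α A) = A := by
  simpa only [face_eq, conn_eq] using C.face_conn_same ⟨hi, hn⟩ α A

theorem fc_succ_cn_same {i : ℕ} (hi : 1 ≤ i) (hn : i ≤ n) (α : Bool) (A : C.cell n) :
    fc (i + 1) α (cn i α A) = A := by
  simpa only [face_eq, conn_eq] using C.face_succ_conn_same ⟨hi, hn⟩ α A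

theorem fc_true_cn {i : ℕ} (hi : 1 ≤ i) (hn : i ≤ n + 1) (A : C.cell (n + 1)) :
    fc i true (cn i false A) = dg i (fc i true A) := by
  simpa only [face_eq, conn_eq, degen_eq, Bool.not_true] using C.face_conn_opp ⟨hi, hn⟩ true A

theorem fc_false_cn {i : ℕ} (hi : 1 ≤ i) (hn : i ≤ n + 1) (A : C.cell (n + 1)) :
    fc i false (cn i true A) = dg i (fc i false A) := by
  simpa only [face_eq, conn_eq, degen_eq, Bool.not_false] using C.face_conn_opp ⟨hi, hn⟩ false A

theorem fc_succ_true_cn {i : ℕ} (hi : 1 ≤ i) (hn : i ≤ n + 1) (A : C.cell (n + 1)) :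
    fc (i + 1) true (cn i false A) = dg i (fc i true A) := by
  simpa only [face_eq, conn_eq, degen_eq, Bool.not_true] using C.face_succ_conn_opp ⟨hi, hn⟩ true A

theorem fc_succ_false_cn {i : ℕ} (hi : 1 ≤ i) (hn : i ≤ n + 1) (A : C.cell (n + 1)) :
    fc (i + 1) false (cn i true A) = dg i (fc i false A) := by
  simpa only [face_eq, conn_eq, degen_eq, Bool.not_false] using
    C.face_succ_conn_opp ⟨hi, hn⟩ false A

theorem dg_dg {i j : ℕ} (hi : 1 ≤ i) (hij : i < j) (hj : j ≤ n + 2) (A : C.cell n) :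
    dg j (dg i A) = dg i (dg (j - 1) A) := by
  have := C.degen_degen (i := i) (j := j) ⟨hi, by omega⟩ ⟨by omega, hj⟩ (by omega) A
  simpa only [degen_eq, lower_of_lt hij, lower_of_gt hij] using this.symm

theorem dg_dg_self {i : ℕ} (hi : 1 ≤ i) (hn : i ≤ n + 1) (A : C.cell n) :
    dg i (dg i A) = dg (i + 1) (dg i A) := by
  rw [dg_dg (j := i + 1) hi (by omega) (by omega), Nat.add_sub_cancel]

theorem cn_cn_self {i : ℕ} (hi : 1 ≤ i) (hn : i ≤ n) (α : Bool) (A : C.cell n) :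
    cn (i + 1) α (cn i α A) = cn i α (cn i α A) := by
  simpa only [conn_eq] using C.conn_conn_self ⟨hi, hn⟩ α A

theorem cn_dg_lt {i j : ℕ} (hi : 1 ≤ i) (hij : i < j) (hj : j ≤ n + 1) (α : Bool)
    (A : C.cell n) : cn i α (dg j A) = dg (j + 1) (cn i α A) := by
  have := C.conn_degen (i := i) (j := j) ⟨hi, by omega⟩ ⟨by omega, hj⟩ (by omega) α A
  simpa only [conn_eq, degen_eq, lower_of_lt hij, raise_of_ge hij.le] using this

theorem cn_dg_gt {i j : ℕ} (hj : 1 ≤ j) (hij : j < i) (hi : i ≤ n + 1) (α : Bool)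
    (A : C.cell n) : cn i α (dg j A) = dg j (cn (i - 1) α A) := by
  have := C.conn_degen (i := i) (j := j) ⟨by omega, by omega⟩ ⟨by omega, by omega⟩ (by omega) α A
  simpa only [conn_eq, degen_eq, lower_of_gt hij, raise_of_lt hij] using this

theorem cn_dg_self {i : ℕ} (hi : 1 ≤ i) (hn : i ≤ n + 1) (α : Bool) (A : C.cell n) :
    cn i α (dg i A) = dg i (dg i A) := by
  simpa only [conn_eq, degen_eq] using C.conn_degen_self ⟨hi, hn⟩ α A

theorem fc_cm_lt {i j : ℕ} (hi : 1 ≤ i) (hij : i < j) (hj : j ≤ n + 2) (α : Bool)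
    {A B : C.cell (n + 2)} (h : fc j true A = fc j false B) :
    fc i α (cm j A B) = cm (j - 1) (fc i α A) (fc i α B) := by
  obtain ⟨h', e⟩ := C.face_comp (i := i) (j := j) ⟨hi, by omega⟩ ⟨by omega, hj⟩ (by omega) α A B
    (by simpa only [face_eq] using h)
  simpa only [comp_eq, face_eq, lower_of_lt hij, lower_of_gt hij] using e

theorem fc_cm_gt {i j : ℕ} (hj : 1 ≤ j) (hij : j < i) (hi : i ≤ n + 2) (α : Bool)
    {A B : C.cell (n + 2)} (h : fc j true A = fc j false B) :
    fc i α (cm j A B) = cm j (fc i α A) (fc i α B) := by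
  obtain ⟨h', e⟩ := C.face_comp (i := i) (j := j) ⟨by omega, hi⟩ ⟨hj, by omega⟩ (by omega) α A B
    (by simpa only [face_eq] using h)
  simpa only [comp_eq, face_eq, lower_of_lt hij, lower_of_gt hij] using e

theorem fc_cm_source (i : ℕ) (A B : C.cell (n + 1)) : fc i false (cm i A B) = fc i false A := by
  by_cases h : ∃ hi : InRange i (n + 1), C.face i hi true A = C.face i hi false B
  · simpa only [comp_eq, face_eq] using C.face_comp_source h.1 A B h.2
  · unfold cm; rw [dif_neg h]

theorem fc_cm_target {i : ℕ} (hi : 1 ≤ i) (hn : i ≤ n + 1) {A B : C.cell (n + 1)}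
    (h : fc i true A = fc i false B) : fc i true (cm i A B) = fc i true B := by
  have e := C.face_comp_target ⟨hi, hn⟩ A B (by simpa only [face_eq] using h)
  rwa [comp_eq, face_eq, face_eq] at e

theorem cm_exchange {i j : ℕ} (hi : 1 ≤ i) (hin : i ≤ n + 1) (hj : 1 ≤ j) (hjn : j ≤ n + 1)
    (hij : i ≠ j) {A B D E : C.cell (n + 1)}
    (hAB : fc i true A = fc i false B) (hDE : fc i true D = fc i false E)
    (hAD : fc j true A = fc j false D) (hBE : fc j true B = fc j false E) :
    cm j (cm i A B) (cm i D E) = cm i (cm j A D) (cm j B E) := by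
  obtain ⟨_, _, e⟩ := C.exchange ⟨hi, hin⟩ ⟨hj, hjn⟩ hij A B D E
    (by simpa only [face_eq] using hAB) (by simpa only [face_eq] using hDE)
    (by simpa only [face_eq] using hAD) (by simpa only [face_eq] using hBE)
  simpa only [comp_eq] using e

theorem cm_assoc {i : ℕ} (hi : 1 ≤ i) (hin : i ≤ n + 1) {A B D : C.cell (n + 1)}
    (hAB : fc i true A = fc i false B) (hBD : fc i true B = fc i false D) :
    cm i (cm i A B) D = cm i A (cm i B D) := by
  obtain ⟨_, _, e⟩ := C.assoc ⟨hi, hin⟩ A B D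
    (by simpa only [face_eq] using hAB) (by simpa only [face_eq] using hBD)
  simpa only [comp_eq] using e.symm

/-- Composability is not assumed: an undefined composite takes its left operand as default value.
The mirror statement `dg_cm` does need the matching face. -/
theorem cm_dg (i : ℕ) (A : C.cell (n + 1)) (X : C.cell n) : cm i A (dg i X) = A := by
  by_cases h : ∃ hi : InRange i (n + 1), C.face i hi true A = C.face i hi false (dg i X)
  · obtain ⟨hi, h⟩ := h
    rw [face_eq, face_eq, fc_dg_self] at h
    subst h
    simpa only [comp_eq, face_eq, degen_eq] using (C.comp_degen hi A).2
  · unfold cm; rw [dif_neg h]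

theorem dg_cm {i : ℕ} (hi : 1 ≤ i) (hin : i ≤ n + 1) {A : C.cell (n + 1)} {X : C.cell n}
    (h : fc i false A = X) : cm i (dg i X) A = A := by
  subst h
  simpa only [comp_eq, face_eq, degen_eq] using (C.degen_comp ⟨hi, hin⟩ A).2

theorem dg_of_cm_le {i j : ℕ} (hi : 1 ≤ i) (hij : i ≤ j) (hj : j ≤ n + 1)
    {A B : C.cell (n + 1)} (h : fc j true A = fc j false B) :
    dg i (cm j A B) = cm (j + 1) (dg i A) (dg i B) := by
  obtain ⟨_, e⟩ := C.degen_of_comp (i := i) (j := j) ⟨hi, by omega⟩ ⟨by omega, hj⟩ A B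
    (by simpa only [face_eq] using h)
  simpa only [comp_eq, degen_eq, raise_of_ge hij] using e

theorem dg_of_cm_gt {i j : ℕ} (hj : 1 ≤ j) (hij : j < i) (hi : i ≤ n + 2)
    {A B : C.cell (n + 1)} (h : fc j true A = fc j false B) :
    dg i (cm j A B) = cm j (dg i A) (dg i B) := by
  obtain ⟨_, e⟩ := C.degen_of_comp (i := i) (j := j) ⟨by omega, hi⟩ ⟨hj, by omega⟩ A B
    (by simpa only [face_eq] using h)
  simpa only [comp_eq, degen_eq, raise_of_lt hij] using e

-- The calculus of faces, which lets `grind` discharge the boundary conditions under which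
-- composites are defined.
attribute [grind =] fc_fc fc_dg_lt fc_dg_gt fc_dg_self fc_cn_lt fc_cn_gt fc_cn_same
  fc_succ_cn_same fc_true_cn fc_false_cn fc_succ_true_cn fc_succ_false_cn dg_dg fc_cm_lt fc_cm_gt
  fc_cm_source fc_cm_target cm_dg dg_cm

theorem cn_cm_cn {i : ℕ} (hi : 1 ≤ i) (hn : i ≤ n) (A : C.cell n) :
    cm i (cn i true A) (cn i false A) = dg (i + 1) A := by
  obtain ⟨_, e⟩ := C.conn_comp_conn ⟨hi, hn⟩ A
  simpa only [comp_eq, degen_eq, conn_eq] using e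

theorem cn_cm_succ_cn {i : ℕ} (hi : 1 ≤ i) (hn : i ≤ n) (A : C.cell n) :
    cm (i + 1) (cn i true A) (cn i false A) = dg i A := by
  obtain ⟨_, e⟩ := C.conn_comp_succ_conn ⟨hi, hn⟩ A
  simpa only [comp_eq, degen_eq, conn_eq] using e

theorem cn_of_cm_lt {i j : ℕ} (hi : 1 ≤ i) (hij : i < j) (hj : j ≤ n + 1) (α : Bool)
    {A B : C.cell (n + 1)} (h : fc j true A = fc j false B) :
    cn i α (cm j A B) = cm (j + 1) (cn i α A) (cn i α B) := by
  obtain ⟨_, e⟩ := C.conn_of_comp (i := i) (j := j) ⟨hi, by omega⟩ ⟨by omega, hj⟩ (by omega) α A B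
    (by simpa only [face_eq] using h)
  simpa only [comp_eq, conn_eq, raise_of_ge hij.le] using e

theorem cn_of_cm_gt {i j : ℕ} (hj : 1 ≤ j) (hij : j < i) (hi : i ≤ n + 1) (α : Bool)
    {A B : C.cell (n + 1)} (h : fc j true A = fc j false B) :
    cn i α (cm j A B) = cm j (cn i α A) (cn i α B) := by
  obtain ⟨_, e⟩ := C.conn_of_comp (i := i) (j := j) ⟨by omega, hi⟩ ⟨hj, by omega⟩ (by omega) α A B
    (by simpa only [face_eq] using h)
  simpa only [comp_eq, conn_eq, raise_of_lt hij] using e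

theorem cn_true_of_cm {i : ℕ} (hi : 1 ≤ i) (hn : i ≤ n + 1) {A B : C.cell (n + 1)}
    (h : fc i true A = fc i false B) :
    cn i true (cm i A B) = cm (i + 1) (cn i true A) (cm i (dg (i + 1) A) (cn i true B)) := by
  obtain ⟨_, _, _, e⟩ := C.conn_true_of_comp ⟨hi, hn⟩ A B (by simpa only [face_eq] using h)
  simpa only [comp_eq, degen_eq, conn_eq, cm_dg] using e

theorem cn_false_of_cm {i : ℕ} (hi : 1 ≤ i) (hn : i ≤ n + 1) {A B : C.cell (n + 1)}
    (h : fc i true A = fc i false B) :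
    cn i false (cm i A B) = cm (i + 1) (cm i (cn i false A) (dg (i + 1) B)) (cn i false B) := by
  obtain ⟨_, _, _, e⟩ := C.conn_false_of_comp ⟨hi, hn⟩ A B (by simpa only [face_eq] using h)
  rw [comp_eq, comp_eq, comp_eq, comp_eq, conn_eq, conn_eq, conn_eq, degen_eq, degen_eq,
    dg_cm hi (by omega) (fc_cn_same hi hn _ _)] at e
  exact e

/-- The 2 × 2 array expressing a connection of a composite can be read along either direction;
interchange passes from the bracketing of the axiom to this one. -/
theorem cn_true_of_cm' {i : ℕ} (hi : 1 ≤ i) (hn : i ≤ n + 1) {A B : C.cell (n + 1)}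
    (h : fc i true A = fc i false B) :
    cn i true (A ⋆[i] B) = cn i true A ⋆[i] (dg i A ⋆[i + 1] cn i true B) := by
  have e := cm_exchange (i := i) (j := i + 1) hi (by omega) (by omega) (by omega) (by omega)
    (A := cn i true A) (B := dg i A) (D := dg (i + 1) A) (E := cn i true B)
    (by grind) (by grind) (by grind) (by grind)
  rw [cm_dg, cm_dg] at e
  rw [cn_true_of_cm hi hn h, e]

theorem cn_false_of_cm' {i : ℕ} (hi : 1 ≤ i) (hn : i ≤ n + 1) {A B : C.cell (n + 1)}
    (h : fc i true A = fc i false B) :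
    cn i false (A ⋆[i] B) = (cn i false A ⋆[i + 1] dg i B) ⋆[i] cn i false B := by
  have e := cm_exchange (i := i) (j := i + 1) hi (by omega) (by omega) (by omega) (by omega)
    (A := cn i false A) (B := dg (i + 1) B) (D := dg i B) (E := cn i false B)
    (by grind) (by grind) (by grind) (by grind)
  rw [dg_cm hi (by omega) (fc_cn_same hi hn _ _),
    dg_cm (by omega) (by omega) (fc_succ_cn_same hi hn _ _)] at e
  rw [cn_false_of_cm hi hn h, e]

/-! ### Invertibility in one direction -/

/-- `A` and `B` are inverse to each other for `⋆_i`. -/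
def IsInv (i : ℕ) (A B : C.cell (n + 1)) : Prop :=
  fc i true A = fc i false B ∧ fc i true B = fc i false A ∧
    A ⋆[i] B = dg i (fc i false A) ∧ B ⋆[i] A = dg i (fc i false B)

/-- `A` has an inverse for `⋆_i`. -/
def HasInv (i : ℕ) (A : C.cell (n + 1)) : Prop := ∃ B, IsInv i A B

theorem isRInvertible_iff {i : ℕ} (hi : InRange i (n + 1)) (A : C.cell (n + 1)) :
    C.IsRInvertible i hi A ↔ HasInv i A := by
  constructor
  · rintro ⟨B, ⟨h, e⟩, h', e'⟩
    rw [comp_eq, degen_eq, face_eq] at e e'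
    rw [face_eq, face_eq] at h h'
    exact ⟨B, h, h', e, h ▸ e'⟩
  · rintro ⟨B, h, h', e, e'⟩
    rw [← face_eq hi, ← face_eq hi] at h h'
    refine ⟨B, ⟨h, ?_⟩, h', ?_⟩
    · rw [comp_eq, degen_eq, face_eq, e]
    · rw [comp_eq, degen_eq, h, face_eq, e']

theorem IsInv.symm {i : ℕ} {A B : C.cell (n + 1)} (h : IsInv i A B) : IsInv i B A :=
  ⟨h.2.1, h.1, h.2.2.2, h.2.2.1⟩

theorem IsInv.unique {i : ℕ} (hi : 1 ≤ i) (hn : i ≤ n + 1) {A B D : C.cell (n + 1)}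
    (h : IsInv i A B) (h' : IsInv i A D) : B = D := by
  obtain ⟨h1, h2, h3, h4⟩ := h
  obtain ⟨k1, k2, k3, k4⟩ := h'
  have := cm_assoc hi hn h2 k1
  rw [h4, k3, cm_dg, dg_cm hi hn (by grind)] at this
  exact this.symm

theorem isInv_dg (i : ℕ) (A : C.cell n) : IsInv i (dg i A) (dg i A) := by
  refine ⟨?_, ?_, ?_, ?_⟩ <;> grind

theorem hasInv_dg (i : ℕ) (A : C.cell n) : HasInv i (dg i A) := ⟨_, isInv_dg i A⟩

theorem IsInv.fc_lt {i j : ℕ} (hj : 1 ≤ j) (hij : j < i) (hi : i ≤ n + 2) (α : Bool)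
    {A B : C.cell (n + 2)} (h : IsInv i A B) : IsInv (i - 1) (fc j α A) (fc j α B) := by
  obtain ⟨h1, h2, h3, h4⟩ := h
  have e3 := congrArg (fc j α) h3
  have e4 := congrArg (fc j α) h4
  rw [fc_cm_lt hj hij hi _ h1, fc_dg_lt hj hij hi] at e3
  rw [fc_cm_lt hj hij hi _ h2, fc_dg_lt hj hij hi] at e4
  refine ⟨?_, ?_, ?_, ?_⟩ <;> grind

theorem IsInv.fc_gt {i j : ℕ} (hi : 1 ≤ i) (hij : i < j) (hj : j ≤ n + 2) (α : Bool)
    {A B : C.cell (n + 2)} (h : IsInv i A B) : IsInv i (fc j α A) (fc j α B) := by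
  obtain ⟨h1, h2, h3, h4⟩ := h
  have e3 := congrArg (fc j α) h3
  have e4 := congrArg (fc j α) h4
  rw [fc_cm_gt hi hij hj _ h1, fc_dg_gt hi hij hj] at e3
  rw [fc_cm_gt hi hij hj _ h2, fc_dg_gt hi hij hj] at e4
  refine ⟨?_, ?_, ?_, ?_⟩ <;> grind

theorem IsInv.cm_self {i : ℕ} (hi : 1 ≤ i) (hn : i ≤ n + 1) {A A' B B' : C.cell (n + 1)}
    (hA : IsInv i A A') (hB : IsInv i B B') (h : fc i true A = fc i false B) :
    IsInv i (A ⋆[i] B) (B' ⋆[i] A') := by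
  obtain ⟨a1, a2, a3, a4⟩ := hA
  obtain ⟨b1, b2, b3, b4⟩ := hB
  refine ⟨by grind, by grind, ?_, ?_⟩
  · rw [cm_assoc hi hn h (by grind), ← cm_assoc hi hn b1 (by grind), b3,
      dg_cm hi hn (by grind), a3]
    grind
  · rw [cm_assoc hi hn (by grind) (by grind), ← cm_assoc hi hn a2 (by grind), a4,
      dg_cm hi hn (by grind), b4]
    grind

theorem HasInv.cm_self {i : ℕ} (hi : 1 ≤ i) (hn : i ≤ n + 1) {A B : C.cell (n + 1)}
    (hA : HasInv i A) (hB : HasInv i B) (h : fc i true A = fc i false B) :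
    HasInv i (A ⋆[i] B) :=
  let ⟨_, a⟩ := hA
  let ⟨_, b⟩ := hB
  ⟨_, a.cm_self hi hn b h⟩

/-- Faces of inverse cells are inverse to each other, and inverses are unique; a shared face
therefore has a shared inverse. -/
theorem IsInv.composable_gt {i j : ℕ} (hi : 1 ≤ i) (hij : i < j) (hj : j ≤ n + 2)
    {A B A' B' : C.cell (n + 2)} (a : IsInv i A A') (b : IsInv i B B')
    (h : fc j true A = fc j false B) : fc j true A' = fc j false B' :=
  (a.fc_gt hi hij hj true).unique hi (by omega) (h ▸ b.fc_gt hi hij hj false)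

theorem IsInv.composable_lt {i j : ℕ} (hj : 1 ≤ j) (hij : j < i) (hi : i ≤ n + 2)
    {A B A' B' : C.cell (n + 2)} (a : IsInv i A A') (b : IsInv i B B')
    (h : fc j true A = fc j false B) : fc j true A' = fc j false B' :=
  (a.fc_lt hj hij hi true).unique (by omega) (by omega) (h ▸ b.fc_lt hj hij hi false)

theorem IsInv.cm_gt {i j : ℕ} (hi : 1 ≤ i) (hij : i < j) (hj : j ≤ n + 2)
    {A B A' B' : C.cell (n + 2)} (a : IsInv i A A') (b : IsInv i B B')
    (h : fc j true A = fc j false B) : IsInv i (A ⋆[j] B) (A' ⋆[j] B') := by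
  have h' := a.composable_gt hi hij hj b h
  have k := congrArg (fc i false) h
  have k' := congrArg (fc i false) h'
  rw [fc_fc hi hij hj, fc_fc hi hij hj] at k k'
  obtain ⟨a1, a2, a3, a4⟩ := a
  obtain ⟨b1, b2, b3, b4⟩ := b
  refine ⟨by grind, by grind, ?_, ?_⟩
  · rw [cm_exchange (by omega) (by omega) (by omega) (by omega) (by omega) h h' a1 b1, a3, b3,
      fc_cm_lt hi hij hj _ h, dg_of_cm_le hi (by omega) (by omega) k,
      Nat.sub_add_cancel (by omega)]
  · rw [cm_exchange (by omega) (by omega) (by omega) (by omega) (by omega) h' h a2 b2, a4, b4,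
      fc_cm_lt hi hij hj _ h', dg_of_cm_le hi (by omega) (by omega) k',
      Nat.sub_add_cancel (by omega)]

theorem IsInv.cm_lt {i j : ℕ} (hj : 1 ≤ j) (hij : j < i) (hi : i ≤ n + 2)
    {A B A' B' : C.cell (n + 2)} (a : IsInv i A A') (b : IsInv i B B')
    (h : fc j true A = fc j false B) : IsInv i (A ⋆[j] B) (A' ⋆[j] B') := by
  have h' := a.composable_lt hj hij hi b h
  have k := congrArg (fc (i - 1) false) h
  have k' := congrArg (fc (i - 1) false) h'
  rw [← fc_fc hj hij hi, ← fc_fc hj hij hi] at k k'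
  obtain ⟨a1, a2, a3, a4⟩ := a
  obtain ⟨b1, b2, b3, b4⟩ := b
  refine ⟨by grind, by grind, ?_, ?_⟩
  · rw [cm_exchange (by omega) (by omega) (by omega) (by omega) (by omega) h h' a1 b1, a3, b3,
      fc_cm_gt hj hij hi _ h, dg_of_cm_gt hj hij hi k]
  · rw [cm_exchange (by omega) (by omega) (by omega) (by omega) (by omega) h' h a2 b2, a4, b4,
      fc_cm_gt hj hij hi _ h', dg_of_cm_gt hj hij hi k']

theorem HasInv.cm_gt {i j : ℕ} (hi : 1 ≤ i) (hij : i < j) (hj : j ≤ n + 2)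
    {A B : C.cell (n + 2)} (hA : HasInv i A) (hB : HasInv i B) (h : fc j true A = fc j false B) :
    HasInv i (A ⋆[j] B) :=
  let ⟨_, a⟩ := hA
  let ⟨_, b⟩ := hB
  ⟨_, a.cm_gt hi hij hj b h⟩

theorem HasInv.cm_lt {i j : ℕ} (hj : 1 ≤ j) (hij : j < i) (hi : i ≤ n + 2)
    {A B : C.cell (n + 2)} (hA : HasInv i A) (hB : HasInv i B) (h : fc j true A = fc j false B) :
    HasInv i (A ⋆[j] B) :=
  let ⟨_, a⟩ := hA
  let ⟨_, b⟩ := hB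
  ⟨_, a.cm_lt hj hij hi b h⟩

/-- Left division: if `A` and `A ⋆_i B` are invertible, so is `B`. -/
theorem HasInv.of_cm_left {i : ℕ} (hi : 1 ≤ i) (hn : i ≤ n + 1) {A B : C.cell (n + 1)}
    (h : fc i true A = fc i false B) (hA : HasInv i A) (hAB : HasInv i (A ⋆[i] B)) :
    HasInv i B := by
  obtain ⟨A', a⟩ := hA
  have e : A' ⋆[i] (A ⋆[i] B) = B := by
    rw [← cm_assoc hi hn a.2.1 h, a.2.2.2, dg_cm hi hn (h ▸ a.1)]
  rw [← e]
  exact .cm_self hi hn ⟨_, a.symm⟩ hAB (by grind [IsInv])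

/-- Right division: if `B` and `A ⋆_i B` are invertible, so is `A`. -/
theorem HasInv.of_cm_right {i : ℕ} (hi : 1 ≤ i) (hn : i ≤ n + 1) {A B : C.cell (n + 1)}
    (h : fc i true A = fc i false B) (hB : HasInv i B) (hAB : HasInv i (A ⋆[i] B)) :
    HasInv i A := by
  obtain ⟨B', b⟩ := hB
  have e : (A ⋆[i] B) ⋆[i] B' = A := by
    rw [cm_assoc hi hn h b.1, b.2.2.1, cm_dg]
  rw [← e]
  exact .cm_self hi hn hAB ⟨_, b.symm⟩ (by grind [IsInv])

/-! ### Degeneracies and connections of invertible cells -/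

theorem HasInv.dg_le {i j : ℕ} (hj : 1 ≤ j) (hij : j ≤ i) (hi : i ≤ n + 1)
    {A : C.cell (n + 1)} (hA : HasInv i A) : HasInv (i + 1) (dg j A) := by
  obtain ⟨A', a1, a2, a3, a4⟩ := hA
  refine ⟨dg j A', by grind, by grind, ?_, ?_⟩
  · rw [← dg_of_cm_le hj hij hi a1, a3]; grind
  · rw [← dg_of_cm_le hj hij hi a2, a4]; grind

theorem HasInv.cn_gt {i j : ℕ} (hi : 1 ≤ i) (hij : i < j) (hj : j ≤ n + 1) (α : Bool)
    {A : C.cell (n + 1)} (hA : HasInv i A) : HasInv i (cn j α A) := by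
  obtain ⟨A', a1, a2, a3, a4⟩ := hA
  obtain ⟨m, rfl⟩ : ∃ m, n = m + 1 := ⟨n - 1, by omega⟩
  refine ⟨cn j α A', by grind, by grind, ?_, ?_⟩
  · rw [← cn_of_cm_gt hi hij hj _ a1, a3, cn_dg_gt hi hij (by omega)]; grind
  · rw [← cn_of_cm_gt hi hij hj _ a2, a4, cn_dg_gt hi hij (by omega)]; grind

theorem cn_true_cm_inv {i : ℕ} (hi : 1 ≤ i) (hn : i ≤ n + 1) {A B : C.cell (n + 1)}
    (h : IsInv i A B) : cn i true A ⋆[i] (dg i A ⋆[i + 1] cn i true B) =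
      dg i (dg i (fc i false A)) := by
  rw [← cn_true_of_cm' hi hn h.1, h.2.2.1, cn_dg_self hi hn]

theorem cn_true_cm_succ_inv {i : ℕ} (hi : 1 ≤ i) (hn : i ≤ n + 1) {A B : C.cell (n + 1)}
    (h : IsInv i A B) : cn i true A ⋆[i + 1] (dg (i + 1) A ⋆[i] cn i true B) =
      dg i (dg i (fc i false A)) := by
  rw [← cn_true_of_cm hi hn h.1, h.2.2.1, cn_dg_self hi hn]

theorem inv_cm_cn_false {i : ℕ} (hi : 1 ≤ i) (hn : i ≤ n + 1) {A B : C.cell (n + 1)}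
    (h : IsInv i A B) : (cn i false B ⋆[i + 1] dg i A) ⋆[i] cn i false A =
      dg i (dg i (fc i false B)) := by
  rw [← cn_false_of_cm' hi hn h.2.1, h.2.2.2, cn_dg_self hi hn]

theorem inv_cm_succ_cn_false {i : ℕ} (hi : 1 ≤ i) (hn : i ≤ n + 1) {A B : C.cell (n + 1)}
    (h : IsInv i A B) : (cn i false B ⋆[i] dg (i + 1) A) ⋆[i + 1] cn i false A =
      dg i (dg i (fc i false B)) := by
  rw [← cn_false_of_cm hi hn h.2.1, h.2.2.2, cn_dg_self hi hn]

/-- The expansion of `Γ_i^+ (A ⋆_i B)`, which is a double degeneracy when `B` is inverse to `A`,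
exhibits `ε_i A ⋆_{i+1} Γ_i^+ B` as a right inverse. The expansion for `B ⋆_i A` shows that it is
also a left inverse. -/
theorem HasInv.cn_true {i : ℕ} (hi : 1 ≤ i) (hn : i ≤ n + 1) {A : C.cell (n + 1)}
    (h : HasInv i A) : HasInv i (cn i true A) := by
  obtain ⟨B, h⟩ := h
  have e1 := cn_true_cm_inv hi hn h
  have e2 := cn_true_cm_inv hi hn h.symm
  obtain ⟨h1, h2, h3, h4⟩ := h
  refine ⟨dg i A ⋆[i + 1] cn i true B, by grind, by grind, by grind, ?_⟩
  -- `Γ_i^+ A` is rewritten as `ε_i A ⋆_{i+1} (ε_i B ⋆_{i+1} Γ_i^+ A)`, so that interchange produces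
  -- the expansion of `Γ_i^+ (B ⋆_i A)`.
  have e3 : (dg i A ⋆[i + 1] cn i true B) ⋆[i] (dg i A ⋆[i + 1] (dg i B ⋆[i + 1] cn i true A)) =
      (dg i A ⋆[i] dg i A) ⋆[i + 1] (cn i true B ⋆[i] (dg i B ⋆[i + 1] cn i true A)) := by
    rw [cm_exchange] <;> grind
  rw [e2, ← cm_assoc (A := dg i A) (B := dg i B) (by omega) (by omega) (by grind) (by grind),
    ← dg_of_cm_le hi le_rfl hn h1, h3, dg_dg_self hi (by omega), dg_dg_self hi (by omega),
    dg_cm (by omega) (by omega) (by grind), cm_dg, cm_dg] at e3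
  rw [e3]
  grind

/-- The argument of `HasInv.cn_true`, with the array for `Γ_i^+ (A ⋆_i B)` bracketed in the other
direction. -/
theorem HasInv.succ_cn_true {i : ℕ} (hi : 1 ≤ i) (hn : i ≤ n + 1) {A : C.cell (n + 1)}
    (h : HasInv i A) : HasInv (i + 1) (cn i true A) := by
  obtain ⟨B, h⟩ := h
  have e1 := cn_true_cm_succ_inv hi hn h
  have e2 := cn_true_cm_succ_inv hi hn h.symm
  have d1 := dg_dg_self hi (by omega) (fc i false A)
  obtain ⟨h1, h2, h3, h4⟩ := h
  refine ⟨dg (i + 1) A ⋆[i] cn i true B, by grind, by grind, by grind, ?_⟩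
  have e3 : (dg (i + 1) A ⋆[i] cn i true B) ⋆[i + 1]
      (dg (i + 1) A ⋆[i] (dg (i + 1) B ⋆[i] cn i true A)) =
      (dg (i + 1) A ⋆[i + 1] dg (i + 1) A) ⋆[i]
        (cn i true B ⋆[i + 1] (dg (i + 1) B ⋆[i] cn i true A)) := by
    rw [cm_exchange] <;> grind
  rw [e2, ← cm_assoc (A := dg (i + 1) A) (B := dg (i + 1) B) (by omega) (by omega) (by grind)
    (by grind), ← dg_of_cm_gt hi (by omega) (by omega) h1, h3, ← dg_dg_self hi (by omega),
    dg_cm (by omega) (by omega) (by grind), cm_dg, cm_dg] at e3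
  rw [e3]
  grind

theorem HasInv.cn_false {i : ℕ} (hi : 1 ≤ i) (hn : i ≤ n + 1) {A : C.cell (n + 1)}
    (h : HasInv i A) : HasInv i (cn i false A) := by
  obtain ⟨B, h⟩ := h
  have e1 := inv_cm_cn_false hi hn h
  have e2 := inv_cm_cn_false hi hn h.symm
  obtain ⟨h1, h2, h3, h4⟩ := h
  refine ⟨cn i false B ⋆[i + 1] dg i A, by grind, by grind, ?_, by grind⟩
  have e3 : ((cn i false A ⋆[i + 1] dg i B) ⋆[i + 1] dg i A) ⋆[i]
      (cn i false B ⋆[i + 1] dg i A) =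
      ((cn i false A ⋆[i + 1] dg i B) ⋆[i] cn i false B) ⋆[i + 1] (dg i A ⋆[i] dg i A) := by
    rw [cm_exchange] <;> grind
  rw [e2, cm_assoc (B := dg i B) (D := dg i A) (by omega) (by omega) (by grind) (by grind),
    ← dg_of_cm_le hi le_rfl hn h2, h4, dg_dg_self hi (by omega), dg_dg_self hi (by omega),
    cm_dg, cm_dg, dg_cm (by omega) (by omega) (by grind)] at e3
  rw [e3]
  grind

theorem HasInv.succ_cn_false {i : ℕ} (hi : 1 ≤ i) (hn : i ≤ n + 1) {A : C.cell (n + 1)}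
    (h : HasInv i A) : HasInv (i + 1) (cn i false A) := by
  obtain ⟨B, h⟩ := h
  have e1 := inv_cm_succ_cn_false hi hn h
  have e2 := inv_cm_succ_cn_false hi hn h.symm
  have d1 := dg_dg_self hi (by omega) (fc i false B)
  obtain ⟨h1, h2, h3, h4⟩ := h
  refine ⟨cn i false B ⋆[i] dg (i + 1) A, by grind, by grind, ?_, by grind⟩
  have e3 : ((cn i false A ⋆[i] dg (i + 1) B) ⋆[i] dg (i + 1) A) ⋆[i + 1]
      (cn i false B ⋆[i] dg (i + 1) A) =
      ((cn i false A ⋆[i] dg (i + 1) B) ⋆[i + 1] cn i false B) ⋆[i]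
        (dg (i + 1) A ⋆[i + 1] dg (i + 1) A) := by
    rw [cm_exchange] <;> grind
  rw [e2, cm_assoc (B := dg (i + 1) B) (D := dg (i + 1) A) (by omega) (by omega) (by grind)
    (by grind), ← dg_of_cm_gt hi (by omega) (by omega) h2, h4, ← dg_dg_self hi (by omega),
    cm_dg, cm_dg, dg_cm (by omega) (by omega) (by grind)] at e3
  rw [e3]
  grind

/-! ### Folding -/

/-- The folding operation `ψ_i` in terms of the total operations. -/
noncomputable def psi (i : ℕ) (A : C.cell (n + 1)) : C.cell (n + 1) :=
  (cn i true (fc (i + 1) false A) ⋆[i + 1] A) ⋆[i + 1] cn i false (fc (i + 1) true A)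

theorem fold_eq {i : ℕ} (hi : InRange i n) (A : C.cell (n + 1)) : C.fold i hi A = psi i A := by
  unfold fold foldLeft psi
  simp only [comp_eq, conn_eq, face_eq]

theorem psi_eq {i : ℕ} (hi : 1 ≤ i) (hn : i ≤ n) (A : C.cell (n + 1)) :
    psi i A =
      cn i true (fc (i + 1) false A) ⋆[i + 1] (A ⋆[i + 1] cn i false (fc (i + 1) true A)) :=
  cm_assoc (by omega) (by omega) (by grind) (by grind)

/-- The four face formulas say that folding pushes the boundary into direction `i`: the two boundary
paths of the `(i, i+1)`-square become source and target, and the faces in direction `i + 1` become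
degenerate. -/
theorem fc_false_psi {i : ℕ} (hi : 1 ≤ i) (hn : i ≤ n + 1) (A : C.cell (n + 2)) :
    fc i false (psi i A) = fc i false A ⋆[i] fc (i + 1) true A := by
  grind [psi]

theorem fc_true_psi {i : ℕ} (hi : 1 ≤ i) (hn : i ≤ n + 1) (A : C.cell (n + 2)) :
    fc i true (psi i A) = fc (i + 1) false A ⋆[i] fc i true A := by
  grind [psi]

theorem fc_succ_false_psi {i : ℕ} (hi : 1 ≤ i) (hn : i ≤ n + 1) (A : C.cell (n + 2)) :
    fc (i + 1) false (psi i A) = dg i (fc i false (fc (i + 1) false A)) := by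
  grind [psi]

theorem fc_succ_true_psi {i : ℕ} (hi : 1 ≤ i) (hn : i ≤ n + 1) (A : C.cell (n + 2)) :
    fc (i + 1) true (psi i A) = dg i (fc i true (fc (i + 1) true A)) := by
  grind [psi]

attribute [grind =] fc_false_psi fc_true_psi fc_succ_false_psi fc_succ_true_psi

/-- Folding does nothing to a cell whose faces in direction `i + 1` are degenerate. -/
theorem psi_of_degenerate {i : ℕ} (hi : 1 ≤ i) (hn : i ≤ n + 1) {A : C.cell (n + 2)}
    {P Q : C.cell n} (hP : fc (i + 1) false A = dg i P) (hQ : fc (i + 1) true A = dg i Q) :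
    psi i A = A := by
  rw [psi, hP, hQ, cn_dg_self hi hn, cn_dg_self hi hn, dg_dg_self hi hn, dg_dg_self hi hn, cm_dg,
    dg_cm (by omega) (by omega) hP]

theorem psi_psi {i : ℕ} (hi : 1 ≤ i) (hn : i ≤ n + 1) (A : C.cell (n + 2)) :
    psi i (psi i A) = psi i A :=
  psi_of_degenerate hi hn (fc_succ_false_psi hi hn A) (fc_succ_true_psi hi hn A)

theorem psi_dg {i : ℕ} (hi : 1 ≤ i) (hn : i ≤ n + 1) (A : C.cell (n + 1)) :
    psi i (dg i A) = dg i A :=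
  psi_of_degenerate hi hn (P := fc i false A) (Q := fc i true A) (by grind) (by grind)

theorem psi_dg_succ {i : ℕ} (hi : 1 ≤ i) (hn : i ≤ n) (A : C.cell n) :
    psi i (dg (i + 1) A) = dg i A := by
  rw [psi, fc_dg_self, fc_dg_self, cm_dg, cn_cm_succ_cn hi hn]

theorem psi_cn_true {i : ℕ} (hi : 1 ≤ i) (hn : i ≤ n + 1) (A : C.cell (n + 1)) :
    psi i (cn i true A) = dg i A := by
  rw [psi, fc_succ_cn_same hi hn, fc_succ_false_cn hi hn, cn_dg_self hi hn,
    dg_dg_self hi (by omega), dg_cm (by omega) (by omega) (by grind), cn_cm_succ_cn hi hn]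

theorem psi_cn_false {i : ℕ} (hi : 1 ≤ i) (hn : i ≤ n + 1) (A : C.cell (n + 1)) :
    psi i (cn i false A) = dg i A := by
  rw [psi, fc_succ_cn_same hi hn, fc_succ_true_cn hi hn, cn_dg_self hi hn,
    dg_dg_self hi (by omega), cm_dg, cn_cm_succ_cn hi hn]

theorem psi_dg_le {i j : ℕ} (hj : 1 ≤ j) (hij : j ≤ i) (hi : i ≤ n + 1)
    (A : C.cell (n + 2)) : psi (i + 1) (dg j A) = dg j (psi i A) := by
  rw [psi, psi, dg_of_cm_le hj (by omega) (by omega) (by grind),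
    dg_of_cm_le hj (by omega) (by omega) (by grind), fc_dg_gt hj (by omega) (by omega),
    fc_dg_gt hj (by omega) (by omega), cn_dg_gt hj (by omega) (by omega),
    cn_dg_gt hj (by omega) (by omega)]
  rfl

/-- A cell is recovered from its folding. -/
theorem unfold_psi {i : ℕ} (hi : 1 ≤ i) (hn : i ≤ n + 1) (A : C.cell (n + 2)) :
    ((dg i (fc i false A) ⋆[i + 1] cn i true (fc (i + 1) true A)) ⋆[i] psi i A) ⋆[i]
      (cn i false (fc (i + 1) false A) ⋆[i + 1] dg i (fc i true A)) = A := by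
  -- Composing with the first factor cancels the trailing connection of `ψ_i A`, through `Γ_i^+ ⋆_i
  -- Γ_i^- = ε_{i+1}`.
  have e1 : (dg i (fc i false A) ⋆[i + 1] cn i true (fc (i + 1) true A)) ⋆[i] psi i A =
      cn i true (fc (i + 1) false A) ⋆[i + 1] (A ⋆[i + 1] dg (i + 1) (fc (i + 1) true A)) := by
    have k := cm_exchange (i := i + 1) (j := i) (by omega) (by omega) hi (by omega) (by omega)
      (A := dg i (fc i false A)) (B := cn i true (fc (i + 1) true A))
      (D := A) (E := cn i false (fc (i + 1) true A)) (by grind) (by grind) (by grind) (by grind)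
    rw [dg_cm hi (by omega) rfl, cn_cm_cn hi hn] at k
    rw [← k, psi_eq hi hn]
    -- The degenerate block above the leading connection completes the array for interchange; it is
    -- an identity for both compositions.
    have k' := cm_exchange (i := i + 1) (j := i) (by omega) (by omega) hi (by omega) (by omega)
      (A := dg i (fc i false (cn i true (fc (i + 1) false A))))
      (B := dg i (fc i false A) ⋆[i + 1] cn i true (fc (i + 1) true A))
      (D := cn i true (fc (i + 1) false A)) (E := A ⋆[i + 1] cn i false (fc (i + 1) true A))
      (by grind) (by grind) (by grind) (by grind)
    rw [dg_cm hi (by omega) rfl, fc_false_cn hi hn, dg_dg_self hi hn,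
      dg_cm (by omega) (by omega) (by grind)] at k'
    exact k'
  rw [e1, cm_dg]
  -- The last factor cancels the leading connection in the same way.
  have k := cm_exchange (i := i + 1) (j := i) (by omega) (by omega) hi (by omega) (by omega)
    (A := cn i true (fc (i + 1) false A)) (B := A)
    (D := cn i false (fc (i + 1) false A)) (E := dg i (fc i true A))
    (by grind) (by grind) (by grind) (by grind)
  rw [k, cm_dg, cn_cm_cn hi hn, dg_cm (by omega) (by omega) rfl]

/-- The unfolding formula involves only the folding and the faces in directions `i` and `i + 1`. -/
theorem psi_injective {i : ℕ} (hi : 1 ≤ i) (hn : i ≤ n + 1) {A B : C.cell (n + 2)}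
    (h : ∀ α, fc i α A = fc i α B) (h' : ∀ α, fc (i + 1) α A = fc (i + 1) α B)
    (e : psi i A = psi i B) : A = B := by
  rw [← unfold_psi hi hn A, ← unfold_psi hi hn B, h, h, h', h', e]

/-! ### Folding of composites -/

/-- Both connections split along `⋆_i` when their faces do, and interchange separates the blocks of
`A` and `B`. Each folding is whiskered by a degenerate face of the other cell. -/
theorem psi_cm_self {i : ℕ} (hi : 1 ≤ i) (hn : i ≤ n + 1) {A B : C.cell (n + 2)}
    (h : fc i true A = fc i false B) :
    psi i (A ⋆[i] B) = (psi i A ⋆[i + 1] dg i (fc (i + 1) true B)) ⋆[i]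
      (dg i (fc (i + 1) false A) ⋆[i + 1] psi i B) := by
  have k := cm_exchange (i := i) (j := i + 1) hi (by omega) (by omega) (by omega) (by omega)
    (A := cn i true (fc (i + 1) false A))
    (B := dg i (fc (i + 1) false A) ⋆[i + 1] cn i true (fc (i + 1) false B)) (D := A) (E := B)
    (by grind) h (by grind) (by grind)
  have k' := cm_exchange (i := i) (j := i + 1) hi (by omega) (by omega) (by omega) (by omega)
    (A := cn i true (fc (i + 1) false A) ⋆[i + 1] A)
    (B := (dg i (fc (i + 1) false A) ⋆[i + 1] cn i true (fc (i + 1) false B)) ⋆[i + 1] B)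
    (D := cn i false (fc (i + 1) true A) ⋆[i + 1] dg i (fc (i + 1) true B))
    (E := cn i false (fc (i + 1) true B))
    (by grind) (by grind) (by grind) (by grind)
  rw [psi, fc_cm_gt hi (by omega) (by omega) _ h, fc_cm_gt hi (by omega) (by omega) _ h,
    cn_true_of_cm' hi hn (by grind), cn_false_of_cm' hi hn (by grind), k, k',]
  congr 1
  · exact (cm_assoc (by omega) (by omega) (by grind) (by grind)).symm
  · rw [psi, cm_assoc (by omega) (by omega) (by grind) (by grind),
      cm_assoc (by omega) (by omega) (by grind) (by grind),
      cm_assoc (by omega) (by omega) (by grind) (by grind)]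

theorem psi_cm_gt {i j : ℕ} (hi : 1 ≤ i) (hij : i + 1 < j) (hj : j ≤ n + 3) {A B : C.cell (n + 3)}
    (h : fc j true A = fc j false B) : psi i (A ⋆[j] B) = psi i A ⋆[j] psi i B := by
  have k (α : Bool) : fc (j - 1) true (fc (i + 1) α A) = fc (j - 1) false (fc (i + 1) α B) := by
    rw [← fc_fc (by omega) hij hj, h, fc_fc (by omega) hij hj]
  have k' (α β : Bool) : fc j true (cn i α (fc (i + 1) β A)) =
      fc j false (cn i α (fc (i + 1) β B)) := by
    rw [fc_cn_gt hi hij hj, k, fc_cn_gt hi hij hj]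
  rw [psi, fc_cm_lt (by omega) hij hj _ h, fc_cm_lt (by omega) hij hj _ h,
    cn_of_cm_lt hi (by omega) (by omega) _ (k _), cn_of_cm_lt hi (by omega) (by omega) _ (k _),
    Nat.sub_add_cancel (by omega),
    cm_exchange (i := j) (j := i + 1) (by omega) (by omega) (by omega) (by omega) (by omega)
      (k' _ _) h (by grind) (by grind),
    cm_exchange (i := j) (j := i + 1) (by omega) (by omega) (by omega) (by omega) (by omega)
      (by have := k' true false; grind) (k' _ _) (by grind) (by grind)]
  rfl

theorem psi_cm_lt {i j : ℕ} (hj : 1 ≤ j) (hij : j < i) (hi : i ≤ n + 2) {A B : C.cell (n + 3)}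
    (h : fc j true A = fc j false B) : psi i (A ⋆[j] B) = psi i A ⋆[j] psi i B := by
  have k (α : Bool) : fc j true (fc (i + 1) α A) = fc j false (fc (i + 1) α B) := by
    have := congrArg (fc i α) h
    grind
  have k' (α β : Bool) : fc j true (cn i α (fc (i + 1) β A)) =
      fc j false (cn i α (fc (i + 1) β B)) := by
    rw [fc_cn_lt hj hij hi, k, fc_cn_lt hj hij hi]
  rw [psi, fc_cm_gt hj (by omega) (by omega) _ h, fc_cm_gt hj (by omega) (by omega) _ h,
    cn_of_cm_gt hj hij hi _ (k _), cn_of_cm_gt hj hij hi _ (k _),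
    cm_exchange (i := j) (j := i + 1) (by omega) (by omega) (by omega) (by omega) (by omega)
      (k' _ _) h (by grind) (by grind),
    cm_exchange (i := j) (j := i + 1) (by omega) (by omega) (by omega) (by omega) (by omega)
      (by have := k' true false; grind) (k' _ _) (by grind) (by grind)]
  rfl

/-- The folding of `B` comes first: pasting two squares along an `(i+1)`-face composes the
associated 2-cells in reverse order. The connections `Γ_i^-` and `Γ_i^+` on the common face cancel.
-/
theorem psi_cm_succ {i : ℕ} (hi : 1 ≤ i) (hn : i ≤ n + 1) {A B : C.cell (n + 2)}
    (h : fc (i + 1) true A = fc (i + 1) false B) :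
    psi i (A ⋆[i + 1] B) = (dg i (fc i false A) ⋆[i + 1] psi i B) ⋆[i]
      (psi i A ⋆[i + 1] dg i (fc i true B)) := by
  have e1 : psi i B ⋆[i] (cn i false (fc (i + 1) false B) ⋆[i + 1] dg i (fc i true B)) =
      B ⋆[i + 1] cn i false (fc (i + 1) true B) := by
    rw [psi_eq hi hn, cm_exchange (i := i + 1) (j := i) (by omega) (by omega) hi (by omega)
      (by omega) (by grind) (by grind) (by grind) (by grind), cn_cm_cn hi hn, cm_dg,
      dg_cm (by omega) (by omega) (by grind)]
  have e2 : (dg i (fc i false A) ⋆[i + 1] psi i B) ⋆[i]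
      (A ⋆[i + 1] (cn i false (fc (i + 1) false B) ⋆[i + 1] dg i (fc i true B))) =
      A ⋆[i + 1] (B ⋆[i + 1] cn i false (fc (i + 1) true B)) := by
    rw [cm_exchange (i := i + 1) (j := i) (by omega) (by omega) hi (by omega)
      (by omega) (by grind) (by grind) (by grind) (by grind), e1, dg_cm hi (by omega) rfl]
  have e3 := cm_exchange (i := i + 1) (j := i) (by omega) (by omega) hi (by omega) (by omega)
    (A := dg i (fc i false (cn i true (fc (i + 1) false A))))
    (B := dg i (fc i false A) ⋆[i + 1] psi i B)
    (D := cn i true (fc (i + 1) false A))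
    (E := A ⋆[i + 1] (cn i false (fc (i + 1) false B) ⋆[i + 1] dg i (fc i true B)))
    (by grind) (by grind) (by grind) (by grind)
  rw [dg_cm hi (by omega) rfl, fc_false_cn hi hn, dg_dg_self hi hn,
    dg_cm (by omega) (by omega) (by grind), e2] at e3
  rw [psi_eq hi hn A, cm_assoc (by omega) (by omega) (by grind) (by grind),
    cm_assoc (by omega) (by omega) (by grind) (by grind), h, e3, psi_eq hi hn, fc_cm_source,
    fc_cm_target (by omega) (by omega) h, cm_assoc (by omega) (by omega) h (by grind)]

/-! ### `T_i`-invertibility in terms of foldings -/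

/-- Connections fold to degeneracies, so attaching one leaves the folding unchanged. -/
theorem psi_square_left {i : ℕ} (hi : 1 ≤ i) (hn : i ≤ n + 1) {u : C.cell (n + 1)}
    {B : C.cell (n + 2)} (h : u = fc i false B) : psi i (cn i true u ⋆[i] B) = psi i B := by
  rw [psi_cm_self hi hn (by grind), psi_cn_true hi hn, fc_succ_false_cn hi hn,
    dg_dg_self hi hn, dg_cm (i := i + 1) (by omega) (by omega) (by grind),
    ← dg_of_cm_le hi le_rfl hn (by grind), dg_cm hi (by omega) (by grind)]

theorem psi_square_right {i : ℕ} (hi : 1 ≤ i) (hn : i ≤ n + 1) {v : C.cell (n + 1)}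
    {A : C.cell (n + 2)} (h : fc i true A = v) : psi i (A ⋆[i] cn i false v) = psi i A := by
  rw [psi_cm_self hi hn (by grind), psi_cn_false hi hn, fc_succ_true_cn hi hn,
    dg_dg_self hi hn, cm_dg, ← dg_of_cm_le hi le_rfl hn (by grind), cm_dg]

/-- The two sides of the `T_i` equation have equal faces in directions `i` and `i + 1`, so by
`psi_injective` they may be compared after folding. The reversal of order in `psi_cm_succ` puts `ψ_i
A` before `ψ_i B`. -/
theorem tSquare_iff {i : ℕ} (hi : 1 ≤ i) (hn : i ≤ n + 1) {A B : C.cell (n + 2)}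
    (hf : ∀ α, fc i α A = fc (i + 1) α B) (hg : ∀ α, fc (i + 1) α A = fc i α B) :
    C.TSquare i ⟨hi, hn⟩ A B ↔ psi i A ⋆[i] psi i B = dg i (fc i false (psi i A)) := by
  have f1 := hf true
  have f2 := hf false
  have g1 := hg true
  have g2 := hg false
  have e1 : psi i ((cn i true (fc (i + 1) false A) ⋆[i] B) ⋆[i + 1]
      (A ⋆[i] cn i false (fc i true A))) = psi i A ⋆[i] psi i B := by
    rw [psi_cm_succ hi hn (by grind), psi_square_right hi hn rfl, psi_square_left hi hn g2,
      fc_cm_source, fc_cm_target hi (by omega) (by grind), fc_false_cn hi hn, fc_true_cn hi hn,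
      dg_dg_self hi hn, dg_dg_self hi hn, cm_dg, dg_cm (by omega) (by omega) (by grind)]
  have e2 : psi i (cn i false (fc i false A) ⋆[i] cn i true (fc (i + 1) true A)) =
      dg i (fc i false (psi i A)) := by
    rw [psi_cm_self hi hn (by grind), psi_cn_false hi hn, psi_cn_true hi hn,
      fc_succ_cn_same hi hn, fc_succ_cn_same hi hn, ← dg_of_cm_le hi le_rfl hn (by grind), cm_dg,
      fc_false_psi hi hn]
  have e3 : (cn i true (fc (i + 1) false A) ⋆[i] B) ⋆[i + 1]
      (A ⋆[i] cn i false (fc i true A)) =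
      cn i false (fc i false A) ⋆[i] cn i true (fc (i + 1) true A) ↔
      psi i A ⋆[i] psi i B = dg i (fc i false (psi i A)) := by
    rw [← e1, ← e2]
    refine ⟨fun h => by rw [h], fun h => psi_injective hi hn ?_ ?_ h⟩
    · rintro (_ | _) <;> grind
    · rintro (_ | _) <;> grind
  rw [← e3]
  unfold TSquare
  simp only [comp_eq, conn_eq, face_eq]
  refine ⟨fun ⟨_, _, _, _, h⟩ => h, fun h => ⟨?_, ?_, ?_, ?_, h⟩⟩ <;> grind

/-- The cell with folding `Y` obtained by transposing the faces of `A`. -/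
theorem exists_transpose {i : ℕ} (hi : 1 ≤ i) (hn : i ≤ n + 1) {A Y : C.cell (n + 2)}
    (h : IsInv i (psi i A) Y) :
    ∃ B : C.cell (n + 2), (∀ α, fc i α A = fc (i + 1) α B) ∧ (∀ α, fc (i + 1) α A = fc i α B) ∧
      psi i B = Y := by
  have y1 : fc (i + 1) false Y = dg i (fc i false (fc (i + 1) false A)) := by
    have := h.fc_gt hi (Nat.lt_succ_self i) (by omega) false
    rw [fc_succ_false_psi hi hn] at this
    exact this.unique hi hn (isInv_dg _ _)
  have y2 : fc (i + 1) true Y = dg i (fc i true (fc (i + 1) true A)) := by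
    have := h.fc_gt hi (Nat.lt_succ_self i) (by omega) true
    rw [fc_succ_true_psi hi hn] at this
    exact this.unique hi hn (isInv_dg _ _)
  have y3 : fc i false Y = fc (i + 1) false A ⋆[i] fc i true A := by
    rw [← h.1, fc_true_psi hi hn]
  have y4 : fc i true Y = fc i false A ⋆[i] fc (i + 1) true A := by
    rw [h.2.1, fc_false_psi hi hn]
  clear h
  have c1 : fc i true (dg i (fc (i + 1) false A) ⋆[i + 1] cn i true (fc i true A)) =
    fc i false Y := by grind
  have c2 : fc i true Y =
    fc i false (cn i false (fc i false A) ⋆[i + 1] dg i (fc (i + 1) true A)) := by grind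
  -- This is the formula of `unfold_psi` with `Y` as folding and the faces of `A` in directions `i`
  -- and `i + 1` exchanged.
  refine ⟨((dg i (fc (i + 1) false A) ⋆[i + 1] cn i true (fc i true A)) ⋆[i] Y) ⋆[i]
    (cn i false (fc i false A) ⋆[i + 1] dg i (fc (i + 1) true A)), ?_, ?_, ?_⟩
  · rintro (_ | _) <;> grind
  · rintro (_ | _) <;> grind
  · have e1 : psi i (dg i (fc (i + 1) false A) ⋆[i + 1] cn i true (fc i true A)) =
        dg i (fc (i + 1) false A ⋆[i] fc i true A) := by
      rw [psi_cm_succ hi hn (by grind), psi_cn_true hi hn, psi_dg hi hn, fc_dg_self,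
        fc_cn_same hi hn, ← dg_of_cm_le hi le_rfl hn (by grind), cm_dg]
    have e2 : psi i (cn i false (fc i false A) ⋆[i + 1] dg i (fc (i + 1) true A)) =
        dg i (fc i false A ⋆[i] fc (i + 1) true A) := by
      rw [psi_cm_succ hi hn (by grind), psi_cn_false hi hn, psi_dg hi hn, fc_dg_self,
        fc_cn_same hi hn, ← dg_of_cm_le hi le_rfl hn (by grind), cm_dg]
    have e3 : psi i Y = Y := psi_of_degenerate hi hn y1 y2
    rw [psi_cm_self hi hn (by grind), psi_cm_self hi hn (by grind), e1, e2, e3,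
      fc_cm_gt hi (Nat.lt_succ_self i) (by omega) _ c1, fc_cm_source,
      fc_dg_gt hi (by omega) (by omega),
      fc_cm_target (by omega) (by omega) (by grind), fc_dg_gt hi (by omega) (by omega),
      Nat.add_sub_cancel, y1, y2, ← dg_of_cm_le hi le_rfl hn (by grind)]
    simp only [dg_dg_self hi hn, cm_dg]
    rw [dg_cm (i := i + 1) (A := Y) (by omega) (by omega) (by grind),
      dg_cm (i := i + 1) (by omega) (by omega) (by grind), cm_dg, dg_cm hi (by omega) y3]

/-- `T_i`-invertibility is `R_i`-invertibility of the folding. -/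
theorem isTInvertible_iff {i : ℕ} (hi : 1 ≤ i) (hn : i ≤ n + 1) (A : C.cell (n + 2)) :
    C.IsTInvertible i ⟨hi, hn⟩ A ↔ HasInv i (psi i A) := by
  unfold IsTInvertible IsTInverse
  simp only [face_eq]
  constructor
  · rintro ⟨B, hf, hg, t1, t2⟩
    rw [tSquare_iff hi hn hf hg] at t1
    rw [tSquare_iff hi hn (fun α => (hg α).symm) (fun α => (hf α).symm)] at t2
    refine ⟨psi i B, ?_, ?_, t1, t2⟩
    · rw [fc_true_psi hi hn, fc_false_psi hi hn, hf, hg]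
    · rw [fc_true_psi hi hn, fc_false_psi hi hn, hf, hg]
  · rintro ⟨Y, h⟩
    obtain ⟨B, hf, hg, rfl⟩ := exists_transpose hi hn h
    refine ⟨B, hf, hg, ?_, ?_⟩
    · rw [tSquare_iff hi hn hf hg]
      exact h.2.2.1
    · rw [tSquare_iff hi hn (fun α => (hg α).symm) (fun α => (hf α).symm)]
      exact h.2.2.2

/-! ### Comparison of invertibility in adjacent directions -/

theorem fc_fc_of_degenerate {i : ℕ} (hi : 1 ≤ i) (hn : i ≤ n + 1) {α : Bool} {X : C.cell (n + 2)}
    {P : C.cell n} (hP : fc (i + 1) α X = dg i P) (β : Bool) : fc i α (fc i β X) = P := by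
  have := congrArg (fc i β) hP
  rwa [fc_fc hi (Nat.lt_succ_self i) (by omega), fc_dg_self] at this

theorem IsInv.fc_of_degenerate {i : ℕ} (hi : 1 ≤ i) (hn : i ≤ n + 1) {α : Bool}
    {X Y : C.cell (n + 2)} {P : C.cell n} (h : IsInv i X Y) (hP : fc (i + 1) α X = dg i P) :
    fc (i + 1) α Y = dg i P :=
  (hP ▸ h.fc_gt hi (Nat.lt_succ_self i) (by omega) α).unique hi hn (isInv_dg _ _)

/-- Read `X` as a 2-cell with source `f₀` and vertical inverse `Y`. By interchange, the horizontal
composite of `X`, `f₀⁻¹` and `Y` is the vertical composite of `f₀ f₀⁻¹ Y = Y` followed by `X f₀⁻¹ f₀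
= X`, hence an identity. -/
theorem IsInv.cm_whisker_inv {i : ℕ} (hi : 1 ≤ i) (hn : i ≤ n + 1) {X Y : C.cell (n + 2)}
    {P Q : C.cell n} (hP : fc (i + 1) false X = dg i P) (hQ : fc (i + 1) true X = dg i Q)
    {f : C.cell (n + 1)} (h : IsInv i X Y) (hf : IsInv i (fc i false X) f) :
    X ⋆[i + 1] (dg i f ⋆[i + 1] Y) = dg i (fc i true X) := by
  have y1 := h.fc_of_degenerate hi hn hP
  have y2 := h.fc_of_degenerate hi hn hQ
  obtain ⟨h1, h2, h3, h4⟩ := h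
  obtain ⟨f1, f2, f3, f4⟩ := hf
  have p1 := fc_fc_of_degenerate hi hn hP
  have p2 := fc_fc_of_degenerate hi hn hQ
  have k := cm_exchange (i := i) (j := i + 1) hi (by omega) (by omega) (by omega) (by omega)
    (A := dg i (fc i false X)) (B := X) (D := dg i f ⋆[i + 1] Y)
    (E := dg i f ⋆[i + 1] dg i (fc i false X)) (by grind) (by grind) (by grind) (by grind)
  rwa [dg_cm hi (by omega) rfl, ← dg_of_cm_le hi le_rfl hn f2, cm_dg, f4, dg_dg_self hi hn, cm_dg,
    ← cm_assoc (A := dg i (fc i false X)) (by omega) (by omega) (by grind) (by grind),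
    ← dg_of_cm_le hi le_rfl hn f1, f3,
    dg_dg_self hi hn, dg_cm (by omega) (by omega) (by grind), h4, ← h1] at k

/-- A cell with degenerate faces in direction `i + 1` which is invertible for `⋆_i`, and whose
faces in direction `i` are invertible, is invertible for `⋆_{i+1}`. -/
theorem HasInv.succ_of_degenerate {i : ℕ} (hi : 1 ≤ i) (hn : i ≤ n + 1) {X : C.cell (n + 2)}
    {P Q : C.cell n} (hP : fc (i + 1) false X = dg i P) (hQ : fc (i + 1) true X = dg i Q)
    (hf : HasInv i (fc i false X)) (hg : HasInv i (fc i true X)) (h : HasInv i X) :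
    HasInv (i + 1) X := by
  obtain ⟨Y, y⟩ := h
  obtain ⟨f, hf⟩ := hf
  obtain ⟨g, hg⟩ := hg
  have y1 := y.fc_of_degenerate hi hn hP
  have y2 := y.fc_of_degenerate hi hn hQ
  have p1 := fc_fc_of_degenerate hi hn hP
  have p2 := fc_fc_of_degenerate hi hn hQ
  have e1 := y.cm_whisker_inv hi hn hP hQ hf
  have e2 := y.symm.cm_whisker_inv hi hn y1 y2 (y.1 ▸ hg)
  obtain ⟨h1, h2, h3, h4⟩ := y
  obtain ⟨f1, f2, f3, f4⟩ := hf
  obtain ⟨g1, g2, g3, g4⟩ := hg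
  -- The usual horizontal inverse of a 2-cell: its vertical inverse, whiskered by the inverses of
  -- source and target.
  refine ⟨dg i f ⋆[i + 1] (Y ⋆[i + 1] dg i g), by grind, by grind, ?_, ?_⟩
  · rw [← cm_assoc (A := dg i f) (by omega) (by omega) (by grind) (by grind),
      ← cm_assoc (A := X) (by omega) (by omega) (by grind) (by grind), e1,
      ← dg_of_cm_le hi le_rfl hn g1, g3, p1, hP, dg_dg_self hi hn]
  · rw [cm_assoc (by omega) (by omega) (by grind) (by grind),
      cm_assoc (by omega) (by omega) (by grind) (by grind), e2, h2,
      ← dg_of_cm_le hi le_rfl hn f2, f4, fc_cm_source, fc_dg_gt hi (by omega) (by omega),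
      dg_dg_self hi hn]
    rfl

/-- The vertical inverse is the horizontal inverse `Z` whiskered by the target of `X` on the left
and its source on the right. Invertibility of the faces need not be assumed: the faces of `Z`
provide their inverses. -/
theorem HasInv.of_succ_of_degenerate {i : ℕ} (hi : 1 ≤ i) (hn : i ≤ n + 1) {X : C.cell (n + 2)}
    {P Q : C.cell n} (hP : fc (i + 1) false X = dg i P) (hQ : fc (i + 1) true X = dg i Q)
    (h : HasInv (i + 1) X) : HasInv i X := by
  obtain ⟨Z, z⟩ := h
  have f := z.fc_lt hi (by omega : i < i + 1) (by omega) false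
  have g := z.fc_lt hi (by omega : i < i + 1) (by omega) true
  rw [Nat.add_sub_cancel] at f g
  obtain ⟨h1, h2, h3, h4⟩ := z
  obtain ⟨f1, f2, f3, f4⟩ := f
  obtain ⟨g1, g2, g3, g4⟩ := g
  have p1 := fc_fc_of_degenerate hi hn hP
  have p2 := fc_fc_of_degenerate hi hn hQ
  have z1 : fc i false ((dg i (fc i true X) ⋆[i + 1] Z) ⋆[i + 1] dg i (fc i false X)) =
      fc i true X := by
    rw [fc_cm_lt hi (by omega) (by omega) _ (by grind), fc_cm_lt hi (by omega) (by omega) _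
      (by grind), fc_dg_self, fc_dg_self, Nat.add_sub_cancel, cm_assoc hi hn (by grind) f2, f4]
    grind
  have z2 : fc i true ((dg i (fc i true X) ⋆[i + 1] Z) ⋆[i + 1] dg i (fc i false X)) =
      fc i false X := by
    rw [fc_cm_lt hi (by omega) (by omega) _ (by grind), fc_cm_lt hi (by omega) (by omega) _
      (by grind), fc_dg_self, fc_dg_self, Nat.add_sub_cancel, g3]
    grind
  refine ⟨(dg i (fc i true X) ⋆[i + 1] Z) ⋆[i + 1] dg i (fc i false X), z1.symm, z2, ?_, ?_⟩
  · have k := cm_exchange (i := i + 1) (j := i) (by omega) (by omega) hi (by omega) (by omega)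
      (A := X) (B := dg i (fc i false Z) ⋆[i + 1] dg i (fc i false X))
      (D := dg i (fc i true X)) (E := Z ⋆[i + 1] dg i (fc i false X))
      (by grind) (by grind) (by grind) (by grind)
    rw [← dg_of_cm_le hi le_rfl hn f2, dg_cm (A := Z ⋆[i + 1] _) hi (by omega) (by grind), f4,
      dg_dg_self hi hn, cm_dg, cm_dg,
      ← cm_assoc (A := X) (by omega) (by omega) (by grind) (by grind), h3,
      dg_cm (by omega) (by omega) (by grind)] at k
    rw [cm_assoc (by omega) (by omega) (by grind) (by grind), k]
  · have k := cm_exchange (i := i + 1) (j := i) (by omega) (by omega) hi (by omega) (by omega)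
      (A := dg i (fc i true X) ⋆[i + 1] Z) (B := dg i (fc i false X))
      (D := dg i (fc i true X) ⋆[i + 1] dg i (fc i true Z)) (E := X)
      (by grind) (by grind) (by grind) (by grind)
    rw [← dg_of_cm_le hi le_rfl hn g1, cm_dg, dg_cm (A := X) hi (by omega) rfl, g3,
      dg_dg_self hi hn, dg_cm (A := X) (by omega) (by omega) (by grind),
      cm_assoc (A := dg i (fc i true X)) (D := X) (by omega) (by omega) (by grind) (by grind), h4,
      cm_dg] at k
    rw [k, z1]

/-- Transfer of invertibility from the folding. -/
theorem HasInv.succ_of_psi {i : ℕ} (hi : 1 ≤ i) (hn : i ≤ n + 1) {A : C.cell (n + 2)}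
    (hu : ∀ α, HasInv i (fc (i + 1) α A)) (hf : ∀ α, HasInv i (fc i α (psi i A)))
    (h : HasInv i (psi i A)) : HasInv (i + 1) A := by
  have k := HasInv.succ_of_degenerate hi hn (fc_succ_false_psi hi hn A)
    (fc_succ_true_psi hi hn A) (hf _) (hf _) h
  -- The two connections in `ψ_i A` are `R_{i+1}`-invertible because the faces they are built on are
  -- `R_i`-invertible, so they cancel.
  exact .of_cm_left (by omega) (by omega) (by grind) ((hu false).succ_cn_true hi hn)
    (.of_cm_right (by omega) (by omega) (by grind) ((hu true).succ_cn_false hi hn) k)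

theorem HasInv.psi_of_succ {i : ℕ} (hi : 1 ≤ i) (hn : i ≤ n + 1) {A : C.cell (n + 2)}
    (hu : ∀ α, HasInv i (fc (i + 1) α A)) (h : HasInv (i + 1) A) : HasInv i (psi i A) := by
  refine .of_succ_of_degenerate hi hn (fc_succ_false_psi hi hn A) (fc_succ_true_psi hi hn A) ?_
  exact (((hu false).succ_cn_true hi hn).cm_self (by omega) (by omega) h (by grind)).cm_self
    (by omega) (by omega) ((hu true).succ_cn_false hi hn) (by grind)

/-- All the factors in the unfolding of `A` are `R_i`-invertible. -/
theorem HasInv.of_psi {i : ℕ} (hi : 1 ≤ i) (hn : i ≤ n + 1) {A : C.cell (n + 2)}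
    (hu : ∀ α, HasInv i (fc (i + 1) α A)) (h : HasInv i (psi i A)) : HasInv i A := by
  rw [← unfold_psi hi hn A]
  refine .cm_self hi (by omega) (.cm_self hi (by omega) (.cm_gt hi (by omega) (by omega)
    (hasInv_dg _ _) ((hu true).cn_true hi hn) (by grind)) h (by grind))
    (.cm_gt hi (by omega) (by omega) ((hu false).cn_false hi hn) (hasInv_dg _ _) (by grind))
    (by grind)

/-! ### Groupoids -/

/-- Each removed folding trades `R_k` for `R_{k+1}`, by `HasInv.succ_of_psi`. -/
theorem hasInv_of_foldUpTo (H : ∀ i, 1 ≤ i → i ≤ n + 1 → ∀ B : C.cell (n + 1), HasInv i B)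
    (k : ℕ) (hk : k ≤ n + 1) (A : C.cell (n + 2)) (h : HasInv 1 (C.foldUpTo k hk A)) :
    HasInv (k + 1) A := by
  induction k generalizing A with
  | zero => exact h
  | succ k ih =>
    have := ih (by omega) _ h
    rw [fold_eq] at this
    exact this.succ_of_psi (by omega) hk (fun _ => H _ (by omega) hk _)
      (fun _ => H _ (by omega) hk _)

/-- Each step down goes through the folding: `R_{k+1}` for `A`, then `R_k` for `ψ_k A`, then `R_k`
for `A`. -/
theorem hasInv_of_le (H : ∀ i, 1 ≤ i → i ≤ n + 1 → ∀ B : C.cell (n + 1), HasInv i B)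
    {i k : ℕ} (hi : 1 ≤ i) (hik : i ≤ k) (hk : k ≤ n + 2) {A : C.cell (n + 2)}
    (h : HasInv k A) : HasInv i A := by
  induction k, hik using Nat.le_induction with
  | base => exact h
  | succ k hik ih =>
    have hu (α : Bool) : HasInv k (fc (k + 1) α A) := H _ (by omega) (by omega) _
    exact ih (by omega) (.of_psi (by omega) (by omega) hu
      (h.psi_of_succ (by omega) (by omega) hu))

theorem hasInv_of_isOmegaGroupoid (h : C.IsOmegaGroupoid) (n i : ℕ) (hi : 1 ≤ i) (hn : i ≤ n + 1)
    (A : C.cell (n + 1)) : HasInv i A := by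
  induction n generalizing i with
  | zero =>
    obtain rfl : i = 1 := by omega
    exact (isRInvertible_iff _ _).1 (h 0 (by omega) A)
  | succ n ih =>
    have := hasInv_of_foldUpTo (fun i hi hn B => ih i hi hn B) (n + 1) le_rfl A
      ((isRInvertible_iff _ _).1 (h (n + 1) (by omega) A))
    exact hasInv_of_le (fun i hi hn B => ih i hi hn B) hi hn le_rfl this

/-! ### Closure properties of `T_i`-invertibility -/

/-- The folding `ψ_i A` is `R_i`-invertible; equivalently, `A` is `T_i`-invertible. -/
def FoldInv (i : ℕ) (A : C.cell (n + 1)) : Prop := HasInv i (psi i A)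

/-- The folding of the composite is a composite of whiskered foldings, and whiskering by cells `ε_i`
preserves `R_i`-invertibility. -/
theorem FoldInv.cm_self {i : ℕ} (hi : 1 ≤ i) (hn : i ≤ n + 1) {A B : C.cell (n + 2)}
    (hA : FoldInv i A) (hB : FoldInv i B) (h : fc i true A = fc i false B) :
    FoldInv i (A ⋆[i] B) := by
  unfold FoldInv
  rw [psi_cm_self hi hn h]
  have k := cm_assoc (A := fc (i + 1) false A) (B := fc i true A) (D := fc (i + 1) true B)
    hi hn (by grind) (by grind)
  exact .cm_self hi (by omega)
    (.cm_gt hi (by omega) (by omega) hA (hasInv_dg _ _) (by grind))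
    (.cm_gt hi (by omega) (by omega) (hasInv_dg _ _) hB (by grind)) (by grind)

theorem FoldInv.cm_succ {i : ℕ} (hi : 1 ≤ i) (hn : i ≤ n + 1) {A B : C.cell (n + 2)}
    (hA : FoldInv i A) (hB : FoldInv i B) (h : fc (i + 1) true A = fc (i + 1) false B) :
    FoldInv i (A ⋆[i + 1] B) := by
  unfold FoldInv
  rw [psi_cm_succ hi hn h]
  have k := cm_assoc (A := fc i false A) (B := fc (i + 1) true A) (D := fc i true B)
    hi hn (by grind) (by grind)
  exact .cm_self hi (by omega)
    (.cm_gt hi (by omega) (by omega) (hasInv_dg _ _) hB (by grind))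
    (.cm_gt hi (by omega) (by omega) hA (hasInv_dg _ _) (by grind)) (by grind)

theorem fc_psi_gt {i j : ℕ} (hi : 1 ≤ i) (hij : i + 1 < j) (hj : j ≤ n + 3) (α : Bool)
    (A : C.cell (n + 3)) : fc j α (psi i A) = psi i (fc j α A) := by
  have k (γ β : Bool) : fc j α (cn i γ (fc (i + 1) β A)) = cn i γ (fc (i + 1) β (fc j α A)) := by
    rw [fc_cn_gt hi hij hj, fc_fc (by omega) hij hj]
  rw [psi, psi, fc_cm_gt (by omega) hij hj _ (by grind),
    fc_cm_gt (by omega) hij hj _ (by grind), k, k]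

theorem fc_psi_lt {i j : ℕ} (hj : 1 ≤ j) (hij : j < i) (hi : i ≤ n + 2) (α : Bool)
    (A : C.cell (n + 3)) : fc j α (psi i A) = psi (i - 1) (fc j α A) := by
  have k (γ β : Bool) : fc j α (cn i γ (fc (i + 1) β A)) = cn (i - 1) γ (fc i β (fc j α A)) := by
    rw [fc_cn_lt hj hij hi, fc_fc hj (by omega) (by omega), Nat.add_sub_cancel]
  rw [psi, psi, fc_cm_lt hj (by omega) (by omega) _ (by grind),
    fc_cm_lt hj (by omega) (by omega) _ (by grind), k, k, Nat.add_sub_cancel,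
    Nat.sub_add_cancel (by omega)]

theorem FoldInv.cm_gt {i j : ℕ} (hi : 1 ≤ i) (hij : i + 1 < j) (hj : j ≤ n + 3)
    {A B : C.cell (n + 3)} (hA : FoldInv i A) (hB : FoldInv i B)
    (h : fc j true A = fc j false B) : FoldInv i (A ⋆[j] B) := by
  unfold FoldInv
  rw [psi_cm_gt hi hij hj h]
  exact HasInv.cm_gt hi (by omega) hj hA hB (by
    rw [fc_psi_gt hi hij hj, fc_psi_gt hi hij hj, h])

theorem FoldInv.cm_lt {i j : ℕ} (hj : 1 ≤ j) (hij : j < i) (hi : i ≤ n + 2)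
    {A B : C.cell (n + 3)} (hA : FoldInv i A) (hB : FoldInv i B)
    (h : fc j true A = fc j false B) : FoldInv i (A ⋆[j] B) := by
  unfold FoldInv
  rw [psi_cm_lt hj hij hi h]
  exact HasInv.cm_lt hj hij (by omega) hA hB (by
    rw [fc_psi_lt hj hij hi, fc_psi_lt hj hij hi, h])

theorem foldInv_dg {i : ℕ} (hi : 1 ≤ i) (hn : i ≤ n + 1) (A : C.cell (n + 1)) :
    FoldInv i (dg i A) := by
  unfold FoldInv
  rw [psi_dg hi hn]
  exact hasInv_dg _ _

theorem foldInv_dg_succ {i : ℕ} (hi : 1 ≤ i) (hn : i ≤ n + 1) (A : C.cell (n + 1)) :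
    FoldInv i (dg (i + 1) A) := by
  unfold FoldInv
  rw [psi_dg_succ hi hn]
  exact hasInv_dg _ _

theorem foldInv_cn {i : ℕ} (hi : 1 ≤ i) (hn : i ≤ n + 1) (α : Bool) (A : C.cell (n + 1)) :
    FoldInv i (cn i α A) := by
  unfold FoldInv
  cases α
  · rw [psi_cn_false hi hn]
    exact hasInv_dg _ _
  · rw [psi_cn_true hi hn]
    exact hasInv_dg _ _

theorem FoldInv.dg_le {i j : ℕ} (hj : 1 ≤ j) (hij : j ≤ i) (hi : i ≤ n + 1)
    {A : C.cell (n + 2)} (h : FoldInv i A) : FoldInv (i + 1) (dg j A) := by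
  unfold FoldInv
  rw [psi_dg_le hj hij hi]
  exact HasInv.dg_le hj hij (by omega) h

theorem foldInv_psi_iff {i : ℕ} (hi : 1 ≤ i) (hn : i ≤ n + 1) (A : C.cell (n + 2)) :
    FoldInv i (psi i A) ↔ FoldInv i A := by
  unfold FoldInv
  rw [psi_psi hi hn]

/-- To prove a property of all cells, closed under composition in directions `i` and `i + 1`, it
suffices to prove it for foldings, degeneracies and connections in direction `i`. -/
theorem psi_induction {i : ℕ} (hi : 1 ≤ i) (hn : i ≤ n + 1) {p : C.cell (n + 2) → Prop}
    (hs : ∀ A B, p A → p B → fc i true A = fc i false B → p (A ⋆[i] B))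
    (ht : ∀ A B, p A → p B → fc (i + 1) true A = fc (i + 1) false B → p (A ⋆[i + 1] B))
    (hd : ∀ A, p (dg i A)) (hc : ∀ α A, p (cn i α A)) {A : C.cell (n + 2)}
    (h : p (psi i A)) : p A := by
  rw [← unfold_psi hi hn A]
  exact hs _ _ (hs _ _ (ht _ _ (hd _) (hc _ _) (by clear hs ht; grind)) h
    (by clear hs ht; grind)) (ht _ _ (hc _ _) (hd _) (by clear hs ht; grind))
    (by clear hs ht; grind)

/-! ### Connections under foldings in adjacent directions -/

theorem cn_succ_dg_dg {i : ℕ} (hi : 1 ≤ i) (hn : i ≤ n + 1) (α : Bool) (A : C.cell n) :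
    cn (i + 1) α (dg i (dg i A)) = dg (i + 2) (dg i (dg i A)) := by
  rw [dg_dg_self hi hn, cn_dg_self (by omega) (by omega), dg_dg_self (by omega) (by omega)]

/-- Since `Γ_{i+1}^+ Γ_i^+ = Γ_i^+ Γ_i^+`, the folding becomes `Γ_i^+` applied to `Γ_i^+ A ⋆_{i+1}
Γ_i^- A = ε_i A`. The equal-sign case is instead handled by `cn_cn_self`. -/
theorem psi_cn_true_cn_false {i : ℕ} (hi : 1 ≤ i) (hn : i ≤ n + 1) (A : C.cell (n + 1)) :
    psi (i + 1) (cn i true (cn i false A)) = dg (i + 1) (dg i A) := by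
  have k (α : Bool) : fc (i + 1 + 1) α (cn i true (cn i false A)) =
      cn i true (fc (i + 1) α (cn i false A)) := fc_cn_gt hi (by omega) (by omega) _ _ _
  rw [psi, k, k, fc_succ_cn_same hi hn, fc_succ_true_cn hi hn, cn_dg_self hi (by omega),
    cn_succ_dg_dg hi hn, cm_dg, cn_cn_self hi hn, ← cn_of_cm_lt hi (by omega) (by omega) _
    (by grind), cn_cm_succ_cn hi hn, cn_dg_self hi (by omega), dg_dg_self hi (by omega)]

theorem psi_cn_false_cn_true {i : ℕ} (hi : 1 ≤ i) (hn : i ≤ n + 1) (A : C.cell (n + 1)) :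
    psi (i + 1) (cn i false (cn i true A)) = dg (i + 1) (dg i A) := by
  have k (α : Bool) : fc (i + 1 + 1) α (cn i false (cn i true A)) =
      cn i false (fc (i + 1) α (cn i true A)) := fc_cn_gt hi (by omega) (by omega) _ _ _
  rw [psi, k, k, fc_succ_cn_same hi hn, fc_succ_false_cn hi hn, cn_dg_self hi (by omega),
    cn_succ_dg_dg hi hn, dg_cm (i := i + 2) (by omega) (by omega) (by grind [cn_dg_self]),
    cn_cn_self hi hn, ← cn_of_cm_lt hi (by omega) (by omega) _ (by grind), cn_cm_succ_cn hi hn,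
    cn_dg_self hi (by omega), dg_dg_self hi (by omega)]

theorem psi_succ_cn_true_cn_false {i : ℕ} (hi : 1 ≤ i) (hn : i ≤ n + 1) (A : C.cell (n + 1)) :
    psi i (cn (i + 1) true (cn i false A)) = dg i (dg (i + 1) A) := by
  rw [psi_eq hi (by omega), fc_false_cn (by omega) (by omega), fc_cn_same (by omega) (by omega),
    fc_succ_cn_same hi hn, ← cn_cn_self hi hn, cn_cm_cn (by omega) (by omega),
    cn_dg_lt hi (by omega) (by omega), ← dg_of_cm_gt (by omega) (by omega) (by omega) (by grind),
    cn_cm_succ_cn hi hn, dg_dg hi (by omega) (by omega)]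
  rfl

theorem psi_succ_cn_false_cn_true {i : ℕ} (hi : 1 ≤ i) (hn : i ≤ n + 1) (A : C.cell (n + 1)) :
    psi i (cn (i + 1) false (cn i true A)) = dg i (dg (i + 1) A) := by
  rw [psi, fc_true_cn (by omega) (by omega), fc_cn_same (by omega) (by omega),
    fc_succ_cn_same hi hn, ← cn_cn_self hi hn, cn_cm_cn (by omega) (by omega),
    cn_dg_lt hi (by omega) (by omega), ← dg_of_cm_gt (by omega) (by omega) (by omega) (by grind),
    cn_cm_succ_cn hi hn, dg_dg hi (by omega) (by omega)]
  rfl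

/-- By `psi_induction` it suffices to treat degeneracies, connections and foldings. The cell `Γ_i^+
ψ_i A` has degenerate faces in direction `i + 2`, so `ψ_{i+1}` fixes it, and it is
`R_{i+1}`-invertible because `ψ_i A` is `R_i`-invertible. -/
theorem foldInv_succ_cn_true {i : ℕ} (hi : 1 ≤ i) (hn : i ≤ n + 1)
    (H : ∀ A : C.cell (n + 2), FoldInv i A) (A : C.cell (n + 2)) :
    FoldInv (i + 1) (cn i true A) := by
  refine psi_induction hi hn (p := fun A => FoldInv (i + 1) (cn i true A)) ?_ ?_ ?_ ?_ ?_
  · intro A B hA hB h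
    rw [cn_true_of_cm' hi (by omega) h]
    exact .cm_lt hi (by omega) (by omega) hA (.cm_self (by omega) (by omega)
      (.dg_le hi le_rfl hn (H _)) hB (by grind)) (by grind)
  · intro A B hA hB h
    rw [cn_of_cm_lt hi (by omega) (by omega) _ h]
    exact .cm_succ (by omega) (by omega) hA hB (by grind)
  · intro A
    rw [cn_dg_self hi (by omega), dg_dg_self hi (by omega)]
    exact foldInv_dg (by omega) (by omega) _
  · rintro (_ | _) A
    · unfold FoldInv
      rw [psi_cn_true_cn_false hi hn]
      exact hasInv_dg _ _
    · rw [← cn_cn_self hi hn]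
      exact foldInv_cn (by omega) (by omega) _ _
  · have h := (H A).succ_cn_true hi (by omega)
    unfold FoldInv
    rwa [psi_of_degenerate (i := i + 1) (P := dg i (fc i false (fc (i + 1) false A)))
      (Q := dg i (fc i true (fc (i + 1) true A))) (by omega) (by omega)]
    · rw [fc_cn_gt hi (by omega) (by omega), Nat.add_sub_cancel, fc_succ_false_psi hi hn,
        cn_dg_self hi hn, dg_dg_self hi hn]
    · rw [fc_cn_gt hi (by omega) (by omega), Nat.add_sub_cancel, fc_succ_true_psi hi hn,
        cn_dg_self hi hn, dg_dg_self hi hn]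

theorem foldInv_succ_cn_false {i : ℕ} (hi : 1 ≤ i) (hn : i ≤ n + 1)
    (H : ∀ A : C.cell (n + 2), FoldInv i A) (A : C.cell (n + 2)) :
    FoldInv (i + 1) (cn i false A) := by
  refine psi_induction hi hn (p := fun A => FoldInv (i + 1) (cn i false A)) ?_ ?_ ?_ ?_ ?_
  · intro A B hA hB h
    rw [cn_false_of_cm' hi (by omega) h]
    exact .cm_lt hi (by omega) (by omega) (.cm_self (by omega) (by omega)
      hA (.dg_le hi le_rfl hn (H _)) (by grind)) hB (by grind)
  · intro A B hA hB h
    rw [cn_of_cm_lt hi (by omega) (by omega) _ h]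
    exact .cm_succ (by omega) (by omega) hA hB (by grind)
  · intro A
    rw [cn_dg_self hi (by omega), dg_dg_self hi (by omega)]
    exact foldInv_dg (by omega) (by omega) _
  · rintro (_ | _) A
    · rw [← cn_cn_self hi hn]
      exact foldInv_cn (by omega) (by omega) _ _
    · unfold FoldInv
      rw [psi_cn_false_cn_true hi hn]
      exact hasInv_dg _ _
  · have h := (H A).succ_cn_false hi (by omega)
    unfold FoldInv
    rwa [psi_of_degenerate (i := i + 1) (P := dg i (fc i false (fc (i + 1) false A)))
      (Q := dg i (fc i true (fc (i + 1) true A))) (by omega) (by omega)]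
    · rw [fc_cn_gt hi (by omega) (by omega), Nat.add_sub_cancel, fc_succ_false_psi hi hn,
        cn_dg_self hi hn, dg_dg_self hi hn]
    · rw [fc_cn_gt hi (by omega) (by omega), Nat.add_sub_cancel, fc_succ_true_psi hi hn,
        cn_dg_self hi hn, dg_dg_self hi hn]

/-- The same reduction, but `Γ_{i+1}^+ ψ_i A` is not fixed by `ψ_i`: the three factors of its
folding are shown to be `R_i`-invertible separately. -/
theorem foldInv_cn_succ_true {i : ℕ} (hi : 1 ≤ i) (hn : i ≤ n + 1)
    (H : ∀ A : C.cell (n + 2), FoldInv i A) (A : C.cell (n + 2)) :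
    FoldInv i (cn (i + 1) true A) := by
  refine psi_induction hi hn (p := fun A => FoldInv i (cn (i + 1) true A)) ?_ ?_ ?_ ?_ ?_
  · intro A B hA hB h
    rw [cn_of_cm_gt hi (by omega) (by omega) _ h]
    exact .cm_self (by omega) (by omega) hA hB (by grind)
  · intro A B hA hB h
    rw [cn_true_of_cm' (by omega) (by omega) h]
    exact .cm_succ hi (by omega) hA (.cm_gt hi (by omega) (by omega)
      (foldInv_dg_succ hi (by omega) _) hB (by grind)) (by grind)
  · intro A
    rw [cn_dg_gt hi (by omega) (by omega)]
    exact foldInv_dg (by omega) (by omega) _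
  · rintro (_ | _) A
    · unfold FoldInv
      rw [psi_succ_cn_true_cn_false hi hn]
      exact hasInv_dg _ _
    · rw [cn_cn_self hi hn]
      exact foldInv_cn (by omega) (by omega) _ _
  · have h : HasInv i (cn i true (fc (i + 1) false (cn (i + 1) true (psi i A)))) := by
      rw [fc_false_cn (by omega) (by omega), fc_succ_false_psi hi hn, ← dg_dg_self hi hn,
        cn_dg_self hi (by omega)]
      exact hasInv_dg _ _
    have h' : HasInv i (cn i false (fc (i + 1) true (cn (i + 1) true (psi i A)))) := by
      rw [fc_cn_same (by omega) (by omega)]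
      exact (H A).cn_false hi (by omega)
    exact HasInv.cm_gt hi (by omega) (by omega) (HasInv.cm_gt hi (by omega) (by omega) h
      (HasInv.cn_gt hi (by omega) (by omega) _ (H A)) (by grind)) h' (by grind)

theorem foldInv_cn_succ_false {i : ℕ} (hi : 1 ≤ i) (hn : i ≤ n + 1)
    (H : ∀ A : C.cell (n + 2), FoldInv i A) (A : C.cell (n + 2)) :
    FoldInv i (cn (i + 1) false A) := by
  refine psi_induction hi hn (p := fun A => FoldInv i (cn (i + 1) false A)) ?_ ?_ ?_ ?_ ?_
  · intro A B hA hB h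
    rw [cn_of_cm_gt hi (by omega) (by omega) _ h]
    exact .cm_self (by omega) (by omega) hA hB (by grind)
  · intro A B hA hB h
    rw [cn_false_of_cm' (by omega) (by omega) h]
    exact .cm_succ hi (by omega) (.cm_gt hi (by omega) (by omega) hA
      (foldInv_dg_succ hi (by omega) _) (by grind)) hB (by grind)
  · intro A
    rw [cn_dg_gt hi (by omega) (by omega)]
    exact foldInv_dg (by omega) (by omega) _
  · rintro (_ | _) A
    · rw [cn_cn_self hi hn]
      exact foldInv_cn (by omega) (by omega) _ _
    · unfold FoldInv
      rw [psi_succ_cn_false_cn_true hi hn]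
      exact hasInv_dg _ _
  · have h : HasInv i (cn i false (fc (i + 1) true (cn (i + 1) false (psi i A)))) := by
      rw [fc_true_cn (by omega) (by omega), fc_succ_true_psi hi hn, ← dg_dg_self hi hn,
        cn_dg_self hi (by omega)]
      exact hasInv_dg _ _
    have h' : HasInv i (cn i true (fc (i + 1) false (cn (i + 1) false (psi i A)))) := by
      rw [fc_cn_same (by omega) (by omega)]
      exact (H A).cn_true hi (by omega)
    exact HasInv.cm_gt hi (by omega) (by omega) (HasInv.cm_gt hi (by omega) (by omega) h'
      (HasInv.cn_gt hi (by omega) (by omega) _ (H A)) (by grind)) h (by grind)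

/-! ### `(ω,1)`-categories -/

/-- Folding and unfolding in direction `i + 1` only compose with connections and degeneracies in
that direction, all of which satisfy `FoldInv i`. -/
theorem foldInv_psi_succ_iff {i : ℕ} (hi : 1 ≤ i) (hn : i ≤ n + 1)
    (H : ∀ A : C.cell (n + 2), FoldInv i A) (A : C.cell (n + 3)) :
    FoldInv i (psi (i + 1) A) ↔ FoldInv i A := by
  have hc : ∀ α (B : C.cell (n + 2)), FoldInv i (cn (i + 1) α B) := by
    rintro (_ | _) B
    · exact foldInv_cn_succ_false hi hn H B
    · exact foldInv_cn_succ_true hi hn H B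
  refine ⟨psi_induction (by omega) (by omega) (fun _ _ a b h => a.cm_succ hi (by omega) b h)
    (fun _ _ a b h => a.cm_gt hi (by omega) (by omega) b h)
    (fun _ => foldInv_dg_succ hi (by omega) _) hc, fun h => ?_⟩
  exact .cm_gt hi (by omega) (by omega) (.cm_gt hi (by omega) (by omega) (hc _ _) h (by grind))
    (hc _ _) (by clear hc H; grind)

theorem foldInv_succ_psi_iff {i : ℕ} (hi : 1 ≤ i) (hn : i ≤ n + 1)
    (H : ∀ A : C.cell (n + 2), FoldInv i A) (A : C.cell (n + 3)) :
    FoldInv (i + 1) (psi i A) ↔ FoldInv (i + 1) A := by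
  have hc : ∀ α (B : C.cell (n + 2)), FoldInv (i + 1) (cn i α B) := by
    rintro (_ | _) B
    · exact foldInv_succ_cn_false hi hn H B
    · exact foldInv_succ_cn_true hi hn H B
  refine ⟨psi_induction hi (by omega) (fun _ _ a b h => a.cm_lt hi (by omega) (by omega) b h)
    (fun _ _ a b h => a.cm_self (by omega) (by omega) b h)
    (fun _ => (H _).dg_le hi le_rfl hn) hc, fun h => ?_⟩
  exact .cm_self (by omega) (by omega) (.cm_self (by omega) (by omega) (hc _ _) h (by grind))
    (hc _ _) (by clear hc H; grind)

theorem FoldInv.hasInv_of_degenerate {i : ℕ} (hi : 1 ≤ i) (hn : i ≤ n + 1) {A : C.cell (n + 2)}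
    (h : FoldInv i A) {P : Bool → C.cell n} (hP : ∀ α, fc (i + 1) α A = dg i (P α)) :
    HasInv i A := by
  unfold FoldInv at h
  rwa [psi_of_degenerate hi hn (hP _) (hP _)] at h

/-- Double degeneracy makes the lower faces of `ψ_{i+1} ψ_i A` degenerate enough to be fixed by
`ψ_i`. For them, `FoldInv i` is therefore `R_i`-invertibility itself, as required when passing
between directions `i` and `i + 1`. -/
theorem exists_fc_psi_psi {i : ℕ} (hi : 1 ≤ i) (hn : i ≤ n + 1) (A : C.cell (n + 3)) :
    ∃ P : Bool → C.cell n, ∀ α, fc (i + 2) α (psi (i + 1) (psi i A)) = dg (i + 1) (dg i (P α)) := by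
  refine ⟨fun α => fc i α (fc i α (fc (i + 1) α A)), ?_⟩
  have k (α : Bool) : fc (i + 1) α (fc (i + 2) α (psi i A)) =
      fc (i + 1) α (fc (i + 1) α (psi i A)) := fc_fc (by omega) (by omega) (by omega) _ _ _
  rintro (_ | _)
  · rw [fc_succ_false_psi (by omega) (by omega), k, fc_succ_false_psi hi (by omega),
      fc_dg_gt hi (by omega) (by omega)]
    rfl
  · rw [fc_succ_true_psi (by omega) (by omega), k, fc_succ_true_psi hi (by omega),
      fc_dg_gt hi (by omega) (by omega)]
    rfl

theorem hasInv_fc_psi_psi {i : ℕ} (hi : 1 ≤ i) (hn : i ≤ n + 1)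
    (H : ∀ A : C.cell (n + 2), FoldInv i A) (A : C.cell (n + 3)) (α : Bool) :
    HasInv i (fc (i + 1) α (psi (i + 1) (psi i A))) := by
  obtain ⟨P, hP⟩ := exists_fc_psi_psi hi hn A
  refine (H _).hasInv_of_degenerate hi hn (P := P) fun β => ?_
  have := fc_fc (i := i + 1) (j := i + 2) (by omega) (by omega) (by omega) α β
    (psi (i + 1) (psi i A))
  rw [hP, fc_dg_self] at this
  exact this.symm

theorem hasInv_fc_psi_psi_psi {i : ℕ} (hi : 1 ≤ i) (hn : i ≤ n + 1)
    (H : ∀ A : C.cell (n + 2), FoldInv i A) (A : C.cell (n + 3)) (α : Bool) :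
    HasInv i (fc i α (psi i (psi (i + 1) (psi i A)))) := by
  obtain ⟨P, hP⟩ := exists_fc_psi_psi hi hn A
  refine (H _).hasInv_of_degenerate hi hn (P := P) fun β => ?_
  have := fc_fc (i := i) (j := i + 2) (by omega) (by omega) (by omega) α β
    (psi i (psi (i + 1) (psi i A)))
  rw [fc_psi_gt hi (by omega) (by omega), hP, psi_dg_succ hi (by omega), fc_dg_self] at this
  exact this.symm

/-- Passing between `T_i` and `T_{i+1}`. -/
theorem foldInv_succ_iff {i : ℕ} (hi : 1 ≤ i) (hn : i ≤ n + 1)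
    (H : ∀ A : C.cell (n + 2), FoldInv i A) (A : C.cell (n + 3)) :
    FoldInv (i + 1) A ↔ FoldInv i A := by
  rw [← foldInv_succ_psi_iff hi hn H, ← foldInv_psi_iff (i := i + 1) (by omega) (by omega),
    ← foldInv_psi_iff (i := i) hi (by omega), ← foldInv_psi_succ_iff hi hn H]
  unfold FoldInv
  rw [psi_psi (by omega) (by omega)]
  exact ⟨fun h => h.psi_of_succ hi (by omega) (hasInv_fc_psi_psi hi hn H A),
    fun h => h.succ_of_psi hi (by omega) (hasInv_fc_psi_psi hi hn H A)
      (hasInv_fc_psi_psi_psi hi hn H A)⟩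

theorem foldInv_of_foldUpTo (H : ∀ i, 1 ≤ i → i ≤ n + 1 → ∀ B : C.cell (n + 2), FoldInv i B)
    (k : ℕ) (hk : k + 1 ≤ n + 2) (A : C.cell (n + 3)) (h : HasInv 1 (C.foldUpTo (k + 1) hk A)) :
    FoldInv (k + 1) A := by
  induction k generalizing A with
  | zero =>
    rw [foldUpTo, foldUpTo, fold_eq] at h
    exact h
  | succ k ih =>
    have := ih (by omega) _ h
    rw [fold_eq] at this
    have H' := H (k + 1) (by omega) (by omega)
    -- First `ψ_{k+2}` is removed without changing the direction `k + 1`; then the direction is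
    -- raised to `k + 2`.
    rw [foldInv_psi_succ_iff (by omega) (by omega) H'] at this
    exact (foldInv_succ_iff (by omega) (by omega) H' A).2 this

theorem foldInv_of_le (H : ∀ i, 1 ≤ i → i ≤ n + 1 → ∀ B : C.cell (n + 2), FoldInv i B)
    {i k : ℕ} (hi : 1 ≤ i) (hik : i ≤ k) (hk : k ≤ n + 2) {A : C.cell (n + 3)}
    (h : FoldInv k A) : FoldInv i A := by
  induction k, hik using Nat.le_induction with
  | base => exact h
  | succ k hik ih =>
    exact ih (by omega)
      ((foldInv_succ_iff (by omega) (by omega) (H k (by omega) (by omega)) A).1 h)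

theorem foldInv_of_isOmegaPCategory_one (h : C.IsOmegaPCategory 1) (n i : ℕ) (hi : 1 ≤ i)
    (hn : i ≤ n + 1) (A : C.cell (n + 2)) : FoldInv i A := by
  induction n generalizing i with
  | zero =>
    obtain rfl : i = 1 := by omega
    have := (isRInvertible_iff _ _).1 (h 1 (by omega) A)
    rw [foldUpTo, foldUpTo, fold_eq] at this
    exact this
  | succ n ih =>
    exact foldInv_of_le (fun i hi hn B => ih i hi hn B) hi hn le_rfl
      (foldInv_of_foldUpTo (fun i hi hn B => ih i hi hn B) (n + 1) le_rfl A
        ((isRInvertible_iff _ _).1 (h (n + 2) (by omega) A)))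

/-- The operation applied last is `ψ_1`, so direction 1 alone is enough. -/
theorem hasInv_foldUpTo_succ (H : ∀ A : C.cell (n + 2), FoldInv 1 A) (k : ℕ)
    (hk : k + 1 ≤ n + 1) (A : C.cell (n + 2)) : HasInv 1 (C.foldUpTo (k + 1) hk A) := by
  induction k generalizing A with
  | zero =>
    rw [foldUpTo, foldUpTo, fold_eq]
    exact H A
  | succ k ih => exact ih (by omega) _

end CubicalOmegaCategory

theorem corollary4p1p4 (C : CubicalOmegaCategory.{u}) :
    (C.IsOmegaGroupoid ↔
      ∀ (n : ℕ) (A : C.cell (n + 1)) (i : ℕ) (hi : 1 ≤ i ∧ i ≤ n + 1),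
        C.IsRInvertible i hi A) ∧
    (C.IsOmegaPCategory 1 ↔
      ∀ (n : ℕ) (A : C.cell (n + 1)) (i : ℕ) (hi : 1 ≤ i ∧ i < n + 1),
        C.IsTInvertible i ⟨hi.1, Nat.le_of_lt_succ hi.2⟩ A) := by
  refine ⟨⟨fun h n A i hi => ?_, fun h n _ A => h n _ 1 _⟩, fun h n A i hi => ?_,
    fun h n hn A => ?_⟩
  · exact (CubicalOmegaCategory.isRInvertible_iff hi A).2
      (CubicalOmegaCategory.hasInv_of_isOmegaGroupoid h n i hi.1 hi.2 A)
  · obtain _ | n := n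
    · omega
    · exact (CubicalOmegaCategory.isTInvertible_iff hi.1 (by omega) A).2
        (CubicalOmegaCategory.foldInv_of_isOmegaPCategory_one h n i hi.1 (by omega) A)
  · obtain _ | n := n
    · omega
    · have H (B : C.cell (n + 2)) : CubicalOmegaCategory.FoldInv 1 B :=
        (CubicalOmegaCategory.isTInvertible_iff le_rfl (by omega) B).1
          (h (n + 1) B 1 ⟨le_rfl, by omega⟩)
      exact (CubicalOmegaCategory.isRInvertible_iff _ _).2
        (CubicalOmegaCategory.hasInv_foldUpTo_succ H n le_rfl A)
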